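/- Let $\mathbb K$ be a field with algebraic closure $\overline{\mathbb K}$, let $r,s\ge 0$, let $f_1,\dots,f_s\in \mathbb K[T_1,\dots,T_r]$ and $I=\langle f_1,\dots,f_s\rangle$. Fix the lexicographic ordering with $T_1>\dots>T_r$ and write $\mathrm{LT}$ for leading terms. A polynomial $f$ has main variable index $k(f)=i$ if $f\in\mathbb K[T_i,\dots,T_r]\setminus\mathbb K[T_{i+1},\dots,T_r]$. For a variable $T_i$ let $\deg_{T_i}(f)$ and $\mathrm{LC}_i(f)$ denote the degree and the leading coefficient of $f$ as a univariate polynomial in $T_i$. A *semi-triangular system* is a tuple $(\mathcal F_\square,\mathcal F_\lhd,k,g)$ with finite sets $\mathcal F_\square,\mathcal F_\lhd$ of polynomials, $0\le k\le r$, and a polynomial $g$, such that every $f\in\mathcal F_\lhd$ has a main variable, with pairwise different indices $k(f)\le k$; $\mathrm{LC}_{k(f)}(f)\mid g$ for $f\in\mathcal F_\lhd$; and no $f\in\mathcal F_\square$ involves $T_1,\dots,T_k$. It is *triangular* if moreover $\mathcal F_\square\subseteq\mathbb K$. Consider the following algorithm **ContainsMonomial** with input $f_1,\dots,f_s$. 1.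 *(Triangular decomposition.)* Start with the list $\mathcal S$ consisting of the single system $(\{f_1,\dots,f_s\},\emptyset,0,T_1\cdots T_r)$. While some $S=(\mathcal F_\square,\mathcal F_\lhd,k,g)\in\mathcal S$ has $k<r$, choose one and do the following. * *Reduce* $\mathcal F_\square$: apply elementary steps of the division algorithm (delete $0$; or, for $f\neq h$ in $\mathcal F_\square$ with $h\ne0$ and a term $t$ of $f$ with $\mathrm{LT}(h)\mid t$, replace $f$ by $f-\frac{t}{\mathrm{LT}(h)}h$) in any order, and stop at some stage at which $0\notin\mathcal F_\square$ and no leading term of an element of $\mathcal F_\square$ divides that of another one. * If at least two elements of $\mathcal F_\square$ involve $T_{k+1}$, choose two such elements $f\ne h$ with $\deg_{T_{k+1}}(f)\ge\deg_{T_{k+1}}(h)>0$, put $b=\mathrm{LC}_{k+1}(h)$, choose $j\ge0$ and $a,u\in\mathbb K[T_{k+1},\dots,T_r]$ with $b^jf=ah+u$ and $\deg_{T_{k+1}}(u)<\deg_{T_{k+1}}(h)$ (for instance $j=\deg_{T_{k+1}}(f)-\deg_{T_{k+1}}(h)+1$), and replace $S$ by the two systems $((\mathcal F_\square\setminus\{f\})\cup\{u\},\mathcal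 F_\lhd,k,bg)$ and $(\mathcal F_\square\cup\{b\},\mathcal F_\lhd,k,g)$. * If exactly one $f=\sum_{i=0}^d a_iT_{k+1}^i\in\mathcal F_\square$ (with $d=\deg_{T_{k+1}}(f)$) involves $T_{k+1}$, replace $S$ by $((\mathcal F_\square\setminus\{f\})\cup\{a_0,\dots,a_d\},\mathcal F_\lhd,k+1,g)$ and the systems $\bigl((\mathcal F_\square\setminus\{f\})\cup\{a_{j+1},\dots,a_d\},\ \mathcal F_\lhd\cup\{\sum_{i\le j}a_iT_{k+1}^i\},\ k+1,\ ga_j\bigr)$ for those $1\le j\le d$ with $a_j\neq0$. * If no element of $\mathcal F_\square$ involves $T_{k+1}$, replace $S$ by $(\mathcal F_\square,\mathcal F_\lhd,k+1,g)$. 2. *(Solvability test.)* Go through the systems $S=(\mathcal F_\square,\mathcal F_\lhd,k,g)$ of the resulting list, which have to be triangular, in any order. * If $\mathcal F_\square$ contains a nonzero constant, $S$ is declared unsolvable. * Otherwise let $k_1<\dots<k_m$ be the main variable indices of the elements of $\mathcal F_\lhd$, let $\mathbb L=\mathbb K(T_i;\,i\notin\{k_1,\dots,k_m\})$, let $\iota\colon\mathbb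 K[T_1,\dots,T_r]\to\mathbb L[T_{k_1},\dots,T_{k_m}]$ be the canonical embedding, and let $F_n$ be the image of the element of $\mathcal F_\lhd$ with main variable $T_{k_n}$. For $n=m,\dots,1$, write $F_n=hT_{k_n}^d+c$ with $d\ge 1$, $0\ne h\in\mathbb L[T_{k_{n+1}},\dots,T_{k_m}]$, $c\in\mathbb L[T_{k_n},\dots,T_{k_m}]$, $\deg_{T_{k_n}}(c)<d$; compute the monic minimal polynomial of the class of $h$ in $\mathbb L[T_{k_{n+1}},\dots,T_{k_m}]/\langle F_{n+1},\dots,F_m\rangle$, write it as $B X^{j+1}+AX^j$ with $B\in\mathbb L[X]$, $A\in\mathbb L^*$, and replace $F_n$ by $T_{k_n}^d-\frac{B(h)}{A}c$. Finally compute a minimal polynomial $p$ of the class of $\iota(g)$ in $R=\mathbb L[T_{k_1},\dots,T_{k_m}]/\langle F_1,\dots,F_m\rangle$. Declare $S$ unsolvable if $p$ is a monomial, and solvable otherwise. * If some $S$ is declared solvable, return *false* and stop. If all are declared unsolvable, return *true*. Here the minimal polynomial of an element $x$ of an $\mathbb L$-algebra of finite dimension $d$ is computed by linear algebra: choose a basis,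 form the $d\times(d+1)$ matrix with columns $x^0,\dots,x^d$, and take a nonzero kernel vector $q$ whose last nonzero entry has minimal position; the polynomial is $\sum_j q_jX^j$ (which is divided by its leading coefficient where a monic polynomial is required). Then, whatever choices are made, the algorithm terminates: there is no infinite run, and every run can be continued until a truth value is returned. It returns *true* if $T^\nu\in I$ for some $\nu\in\mathbb Z_{\ge0}^r$, and *false* otherwise. Moreover, $I$ contains such a monomial if and only if $V(I)\cap(\overline{\mathbb K}^*)^r=\emptyset$, where $V(I)\subseteq\overline{\mathbb K}^r$ is the zero set of $I$. -/

import Mathlib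

namespace MonomialContainment

open MvPolynomial

section Coefficients

variable {σ : Type*} {K : Type*} [CommSemiring K]

/-- The coefficient of `T_i ^ n` in `f`, where `f` is viewed as a univariate polynomial in `T_i`
over the polynomial ring in the remaining variables. -/
noncomputable def coeffIn (i : σ) (n : ℕ) (f : MvPolynomial σ K) : MvPolynomial σ K :=
  ∑ m ∈ f.support with m i = n, monomial (m.erase i) (f.coeff m)

/-- The leading coefficient of `f`, viewed as a univariate polynomial in `T_i`. -/
noncomputable def leadCoeffIn (i : σ) (f : MvPolynomial σ K) : MvPolynomial σ K :=
  coeffIn i (f.degreeOf i) f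

/-- The truncation `∑_{i ≤ j} a_i T_t ^ i` of `f = ∑_i a_i T_t ^ i`. -/
noncomputable def truncIn (t : σ) (j : ℕ) (f : MvPolynomial σ K) : MvPolynomial σ K :=
  ∑ i ∈ Finset.range (j + 1), coeffIn t i f * X t ^ i

/-- `i` is the main variable `k(f)` of `f`:
`f` lies in `K[T_j ; j ≥ i]` but not in `K[T_j ; j > i]`. -/
def HasMainVar [LinearOrder σ] (f : MvPolynomial σ K) (i : σ) : Prop :=
  f ∈ supported K (Set.Ici i) ∧ f ∉ supported K (Set.Ioi i)

/-- A finite set of polynomials is of triangular shape: every member has a main variable, and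
different members have different main variables. -/
def TriangularShape [LinearOrder σ] (F : Finset (MvPolynomial σ K)) : Prop :=
  (∀ f ∈ F, ∃ i, HasMainVar f i) ∧
    ∀ f ∈ F, ∀ h ∈ F, ∀ i, HasMainVar f i → HasMainVar h i → f = h

end Coefficients

section Systems

/-- The data `(F_□, F_◁, k, g)` of a system in `K[T_1, …, T_r]`. The variable `T_(i+1)` is
`X i` with `i : Fin r`; thus `T_1, …, T_k` are the `X i` with `i < k`. -/
structure System (r : ℕ) (K : Type*) [Field K] where
  /-- the polynomials `F_□` that still have to be treated -/
  unsorted : Finset (MvPolynomial (Fin r) K)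
  /-- the polynomials `F_◁` in triangular shape -/
  sorted : Finset (MvPolynomial (Fin r) K)
  /-- the number of variables already treated -/
  k : ℕ
  /-- the polynomial `g` of the inequation `g ≠ 0` -/
  ineq : MvPolynomial (Fin r) K

variable {r : ℕ} {K : Type*} [Field K]

/-- `S` is a semi-triangular system. -/
structure System.IsSemiTriangular (S : System r K) : Prop where
  k_le : S.k ≤ r
  shape : TriangularShape S.sorted
  lead_dvd : ∀ f ∈ S.sorted, ∀ i, HasMainVar f i → leadCoeffIn i f ∣ S.ineq
  main_lt : ∀ f ∈ S.sorted, ∀ i, HasMainVar f i → (i : ℕ) < S.k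
  unsorted_free : ∀ f ∈ S.unsorted, ∀ i : Fin r, (i : ℕ) < S.k → f.degreeOf i = 0

/-- `S` is a triangular system: it is semi-triangular and all members of `F_□` are constants. -/
def System.IsTriangular (S : System r K) : Prop :=
  S.IsSemiTriangular ∧ ∀ f ∈ S.unsorted, ∃ c : K, f = C c

end Systems

section Triangulation

variable {r : ℕ} {K : Type*} [Field K]

/-- No member of `F` vanishes, and no leading term of a member of `F` divides the leading term of
another one, for the lexicographic ordering with `T_1 > ⋯ > T_r`. -/
def Interreduced (F : Finset (MvPolynomial (Fin r) K)) : Prop :=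
  0 ∉ F ∧ ∀ f ∈ F, ∀ h ∈ F, f ≠ h →
    ¬ MonomialOrder.lex.degree f ≤ MonomialOrder.lex.degree h

open Classical in
/-- An elementary step of the division algorithm applied to the members of a finite set `F`:
remove the zero polynomial, or cancel some term `c T^m` of some `f ∈ F` that is divisible by the
leading term of another `h ∈ F`, by subtracting the suitable multiple of `h` from `f`. -/
inductive ReduceStep (F : Finset (MvPolynomial (Fin r) K)) :
    Finset (MvPolynomial (Fin r) K) → Prop
  | dropZero (h0 : 0 ∈ F) : ReduceStep F (F.erase 0)
  | divide (f h : MvPolynomial (Fin r) K) (hf : f ∈ F) (hh : h ∈ F) (hfh : h ≠ f) (h0 : h ≠ 0)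
      (m : Fin r →₀ ℕ) (hm : m ∈ f.support) (hdvd : MonomialOrder.lex.degree h ≤ m) :
      ReduceStep F (insert
        (f - monomial (m - MonomialOrder.lex.degree h)
          (f.coeff m / MonomialOrder.lex.leadingCoeff h) * h) (F.erase f))

open Classical in
/-- `Expand S M`: the body of the while-loop of the triangular decomposition, after the reduction
of `F_□`, may replace the system `S` (with `S.k < r`) by the systems in `M`. Here `T_(k+1)` is
`X t` with `t = ⟨S.k, hk⟩`. -/
inductive Expand (S : System r K) : Multiset (System r K) → Prop
  /-- Two members `f`, `h` of `F_□` involve `T_(k+1)`: divide the one of larger degree by the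
  other, `b ^ j * f = a * h + u` with `b` the leading coefficient of `h`, and distinguish
  `b ≠ 0` and `b = 0`. -/
  | pseudoDivide (hk : S.k < r) (f h : MvPolynomial (Fin r) K)
      (hf : f ∈ S.unsorted) (hh : h ∈ S.unsorted) (hne : h ≠ f)
      (hpos : 0 < h.degreeOf ⟨S.k, hk⟩)
      (hdeg : h.degreeOf ⟨S.k, hk⟩ ≤ f.degreeOf ⟨S.k, hk⟩)
      (j : ℕ) (a u : MvPolynomial (Fin r) K)
      (ha : a ∈ supported K {i : Fin r | S.k ≤ (i : ℕ)})
      (hu : u ∈ supported K {i : Fin r | S.k ≤ (i : ℕ)})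
      (heq : leadCoeffIn ⟨S.k, hk⟩ h ^ j * f = a * h + u)
      (hlt : u.degreeOf ⟨S.k, hk⟩ < h.degreeOf ⟨S.k, hk⟩) :
      Expand S
        {⟨insert u (S.unsorted.erase f), S.sorted, S.k, leadCoeffIn ⟨S.k, hk⟩ h * S.ineq⟩,
         ⟨insert (leadCoeffIn ⟨S.k, hk⟩ h) S.unsorted, S.sorted, S.k, S.ineq⟩}
  /-- Exactly one `f = ∑_{i ≤ d} a_i T_(k+1) ^ i` in `F_□` involves `T_(k+1)`: distinguish which
  `a_j` (`1 ≤ j ≤ d`) is the last non-vanishing one, if any. The index `j` is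
  only used if `a_j` is not the zero polynomial. -/
  | lastPolynomial (hk : S.k < r) (f : MvPolynomial (Fin r) K) (hf : f ∈ S.unsorted)
      (hpos : 0 < f.degreeOf ⟨S.k, hk⟩)
      (huniq : ∀ h ∈ S.unsorted, h ≠ f → h.degreeOf ⟨S.k, hk⟩ = 0) :
      Expand S
        (⟨S.unsorted.erase f ∪
            (Finset.range (f.degreeOf ⟨S.k, hk⟩ + 1)).image (fun i => coeffIn ⟨S.k, hk⟩ i f),
          S.sorted, S.k + 1, S.ineq⟩ ::ₘ
        ((Finset.Icc 1 (f.degreeOf ⟨S.k, hk⟩)).filter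
            (fun j => coeffIn ⟨S.k, hk⟩ j f ≠ 0)).val.map (fun j =>
          ⟨S.unsorted.erase f ∪
              (Finset.Ioc j (f.degreeOf ⟨S.k, hk⟩)).image (fun i => coeffIn ⟨S.k, hk⟩ i f),
            insert (truncIn ⟨S.k, hk⟩ j f) S.sorted, S.k + 1,
            S.ineq * coeffIn ⟨S.k, hk⟩ j f⟩))
  /-- No member of `F_□` involves `T_(k+1)`. -/
  | unusedVariable (hk : S.k < r) (hfree : ∀ f ∈ S.unsorted, f.degreeOf ⟨S.k, hk⟩ = 0) :
      Expand S {⟨S.unsorted, S.sorted, S.k + 1, S.ineq⟩}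

end Triangulation

section MinimalPolynomials

/-- `p` is a possible output of the computation of the minimal polynomial of `x ∈ R` by linear
algebra: choose a basis of `R` over `L`, with `d` elements, write `x ^ 0, …, x ^ d` as the columns
of a `d × (d + 1)` matrix, choose a nonzero vector `q` of its kernel whose last nonzero entry has
the smallest possible position, and put `p = ∑ q_j X ^ j`. -/
def MinPolyOutput {L R : Type*} [Field L] [CommRing R] [Algebra L R] (x : R)
    (p : Polynomial L) : Prop :=
  ∃ (d : ℕ) (B : Module.Basis (Fin d) L R) (M : Matrix (Fin d) (Fin (d + 1)) L)
    (q : Fin (d + 1) → L),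
    (∀ i j, M i j = B.repr (x ^ (j : ℕ)) i) ∧ M.mulVec q = 0 ∧ q ≠ 0 ∧
    (∀ q' : Fin (d + 1) → L, M.mulVec q' = 0 → q' ≠ 0 →
      ∀ j, q j ≠ 0 → ∃ j', j ≤ j' ∧ q' j' ≠ 0) ∧
    p = ∑ j, Polynomial.C (q j) * Polynomial.X ^ (j : ℕ)

end MinimalPolynomials

section MakeMonic

variable {σ : Type*} [LinearOrder σ] {L : Type*} [Field L]

/-- The quotient ring `L[T_i ; i > n] / ⟨f_i ; i > n⟩`. -/
abbrev TailQuotient (f : σ → MvPolynomial σ L) (n : σ) : Type _ :=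
  ↥(supported L (Set.Ioi n)) ⧸
    Ideal.span {x : ↥(supported L (Set.Ioi n)) | ∃ i, n < i ∧ (x : MvPolynomial σ L) = f i}

/-- One pass of the loop that makes a dense triangular system monic: `f'` is the new value of
`f_n`, where `f` holds the already treated polynomials `f_i`, `i > n`. With
`f_n = h T_n ^ d + c` and `p = b X ^ (j + 1) + a X ^ j`, `a ≠ 0`, the monic minimal polynomial of
the class of `h`, the new value is `T_n ^ d + h' c` with `h' = - b(h) / a`. -/
def MonicPass (f : σ → MvPolynomial σ L) (n : σ) (fn f' : MvPolynomial σ L) : Prop :=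
  ∃ (h : ↥(supported L (Set.Ioi n))) (c : MvPolynomial σ L) (d : ℕ),
    1 ≤ d ∧ fn = (h : MvPolynomial σ L) * X n ^ d + c ∧ (h : MvPolynomial σ L) ≠ 0 ∧
    c ∈ supported L (Set.Ici n) ∧ c.degreeOf n < d ∧
    ∃ (p b : Polynomial L) (a : L) (j : ℕ),
      MinPolyOutput (Ideal.Quotient.mk _ h : TailQuotient f n) p ∧ p.Monic ∧ a ≠ 0 ∧
      p = b * Polynomial.X ^ (j + 1) + Polynomial.C a * Polynomial.X ^ j ∧
      f' = X n ^ d + (C (-a⁻¹) * Polynomial.aeval (h : MvPolynomial σ L) b) * c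

/-- `f'` is an output of the procedure that makes the dense triangular system
`f` (with `k(f_n) = n`) monic. The loop runs from the last variable down to the first one; when
`n` is treated, the polynomials with index `> n` have already received their final value. -/
def MakeMonicOutput (f f' : σ → MvPolynomial σ L) : Prop :=
  ∀ n, MonicPass f' n (f n) (f' n)

end MakeMonic

section Solvability

variable {r : ℕ} {K : Type*} [Field K]

/-- The function field `K(T_i ; i ∉ J)`. -/
abbrev FunctionField (K : Type*) [Field K] {r : ℕ} (J : Set (Fin r)) : Type _ :=
  FractionRing (MvPolynomial (↥(Jᶜ)) K)

open Classical in
/-- The canonical embedding `K[T_1, …, T_r] → L[T_i ; i ∈ J]` with `L = K(T_i ; i ∉ J)`. -/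
noncomputable def fieldSwap (J : Set (Fin r)) :
    MvPolynomial (Fin r) K →ₐ[K] MvPolynomial (↥J) (FunctionField K J) :=
  aeval fun i =>
    if h : i ∈ J then X ⟨i, h⟩
    else C (algebraMap (MvPolynomial (↥(Jᶜ)) K) (FunctionField K J) (X ⟨i, h⟩))

/-- The indices `k_1, …, k_s` of the main variables of the polynomials in `F_◁`. -/
def System.mainVars (S : System r K) : Set (Fin r) :=
  {i | ∃ f ∈ S.sorted, HasMainVar f i}

/-- `p` is a possible value of the polynomial `p_{g'}` computed by the solvability test for the
triangular system `S`: pass to the dense system over the function field, make it monic, and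
compute the minimal polynomial of the class of the image of `g`. -/
def TestPolynomial (S : System r K) (p : Polynomial (FunctionField K S.mainVars)) : Prop :=
  ∃ f f' : ↥S.mainVars → MvPolynomial (↥S.mainVars) (FunctionField K S.mainVars),
    (∀ i : ↥S.mainVars, ∃ q ∈ S.sorted, HasMainVar q (i : Fin r) ∧ f i = fieldSwap S.mainVars q) ∧
    MakeMonicOutput f f' ∧
    MinPolyOutput
      (Ideal.Quotient.mk (Ideal.span (Set.range f')) (fieldSwap S.mainVars S.ineq)) p

/-- `IsSolvable S b`: the solvability test for the triangular system `S` may return `b`. -/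
inductive IsSolvable (S : System r K) : Bool → Prop
  | unit (hS : S.IsTriangular) (c : K) (hc : c ≠ 0) (hmem : C c ∈ S.unsorted) :
      IsSolvable S false
  | isMonomial (hS : S.IsTriangular) (hno : ∀ c : K, c ≠ 0 → C c ∉ S.unsorted)
      (p : Polynomial (FunctionField K S.mainVars)) (hp : TestPolynomial S p)
      (hmon : ∃ n c, p = Polynomial.monomial n c) :
      IsSolvable S false
  | notMonomial (hS : S.IsTriangular) (hno : ∀ c : K, c ≠ 0 → C c ∉ S.unsorted)
      (p : Polynomial (FunctionField K S.mainVars)) (hp : TestPolynomial S p)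
      (hmon : ¬ ∃ n c, p = Polynomial.monomial n c) :
      IsSolvable S true

end Solvability

section Algorithm

variable {r : ℕ} {K : Type*} [Field K]

/-- The states of the algorithm. -/
inductive Config (r : ℕ) (K : Type*) [Field K]
  /-- at the head of the while-loop of the triangular decomposition, with the given list -/
  | loop (M : Multiset (System r K))
  /-- the system `S` has been picked (the others are `M`), and `F_□` is being reduced -/
  | reducing (S : System r K) (M : Multiset (System r K))
  /-- in the final loop; the systems in `M` still have to be tested -/
  | testing (M : Multiset (System r K))
  /-- the algorithm has returned `b` -/
  | done (b : Bool)

/-- `Step c c'`: the algorithm may pass from the state `c` to the state `c'`. -/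
inductive Step : Config r K → Config r K → Prop
  | pick (S : System r K) (M : Multiset (System r K)) (hk : S.k < r) :
      Step (.loop (S ::ₘ M)) (.reducing S M)
  | reduce (S : System r K) (M : Multiset (System r K)) (F : Finset (MvPolynomial (Fin r) K))
      (hF : ReduceStep S.unsorted F) :
      Step (.reducing S M) (.reducing ⟨F, S.sorted, S.k, S.ineq⟩ M)
  | expand (S : System r K) (M N : Multiset (System r K)) (hred : Interreduced S.unsorted)
      (hN : Expand S N) :
      Step (.reducing S M) (.loop (N + M))
  | triangulated (M : Multiset (System r K)) (hM : ∀ S ∈ M, ¬ S.k < r) :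
      Step (.loop M) (.testing M)
  | solvable (S : System r K) (M : Multiset (System r K)) (hS : IsSolvable S true) :
      Step (.testing (S ::ₘ M)) (.done false)
  | unsolvable (S : System r K) (M : Multiset (System r K)) (hS : IsSolvable S false) :
      Step (.testing (S ::ₘ M)) (.testing M)
  | finished : Step (.testing 0) (.done true)

open Classical in
/-- The initial state for the input `f_1, …, f_s`: the single system
`({f_1, …, f_s}, ∅, 0, T_1 ⋯ T_r)`. -/
noncomputable def start {s : ℕ} (f : Fin s → MvPolynomial (Fin r) K) : Config r K :=
  .loop {⟨Finset.univ.image f, ∅, 0, ∏ i, X i⟩}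

end Algorithm

end MonomialContainment

/-! Let V be the set of common zeros of the input in the torus over `AlgebraicClosure K`.

Correctness. A reduction step rewrites equations modulo one another. An expansion splits the points
according to whether certain coefficients vanish, and records the nonvanishing ones in g. Hence the
solution sets of the current systems always cover exactly V (`ReduceStep.forall_aeval_eq_zero_iff`,
`Expand.mem_solutions_iff`). That V is empty exactly if the ideal contains a monomial is the
Nullstellensatz applied to T_1 ⋯ T_r.

Solvability of a triangular system. A minimal polynomial is a monomial exactly if the element is
nilpotent, so the test asks whether g is nilpotent in R. Wherever g does not vanish, neither do the
leading coefficients, and making the system monic merely divides by them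
(`MonicPass.map_eq_zero_iff`). If g is not nilpotent, a prime of R avoiding g pulls back to K[T_1,
…, T_r], and the Nullstellensatz gives a solution. The converse is the delicate point: a solution
assigns special values to the free variables, whereas R only sees generic ones. In
`exists_generic_zero` the solution becomes the reduction, modulo the maximal ideal of a valuation
ring, of a zero whose free coordinates are algebraically independent. The remaining coordinates are
lifted one by one as roots of polynomials with unit leading coefficient.

Termination. Systems are compared lexicographically by r - k, by the sum of the degrees in T_(k+1),
by the initial ideal (larger is smaller), and by the multiset of supports. Pseudo-remainders lower
the degree sum. Adjoining a leading coefficient to an interreduced set enlarges the initial ideal.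
Division steps lower the supports without harming the earlier entries. Multisets of systems then
decrease in the induced order. -/

namespace MonomialContainment

open MvPolynomial

/-! ### Polynomials as univariate polynomials in one variable; main variables -/

section Coefficients

variable {σ : Type*} {K : Type*} [CommSemiring K]

theorem mem_supported_iff_forall_degreeOf {s : Set σ} {f : MvPolynomial σ K} :
    f ∈ supported K s ↔ ∀ i, i ∉ s → f.degreeOf i = 0 := by
  classical
  rw [mem_supported]
  constructor
  · intro h i hi
    by_contra h0
    exact hi (h ((mem_vars_iff_mem_support i).2 (by
      by_contra hc
      push Not at hc
      apply h0
      rw [← Nat.le_zero, degreeOf_le_iff]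
      intro m hm
      have := hc m hm
      simp at this
      exact this.le)))
  · intro h i hi
    by_contra hs
    obtain ⟨m, hm, him⟩ := (mem_vars_iff_mem_support i).1 hi
    have := degreeOf_le_iff.1 (h i hs).le m hm
    simp at him
    omega

theorem apply_eq_zero_of_mem_supported {s : Set σ} {f : MvPolynomial σ K}
    (hf : f ∈ supported K s) {m : σ →₀ ℕ} (hm : m ∈ f.support) {i : σ} (hi : i ∉ s) : m i = 0 :=
  Nat.le_zero.1 (degreeOf_le_iff.1 (mem_supported_iff_forall_degreeOf.1 hf i hi).le m hm)

theorem coeff_coeffIn (i : σ) (n : ℕ) (f : MvPolynomial σ K) (m : σ →₀ ℕ) :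
    coeff m (coeffIn i n f) = if m i = 0 then coeff (m + Finsupp.single i n) f else 0 := by
  classical
  rw [coeffIn, coeff_sum]
  simp only [coeff_monomial]
  split_ifs with h
  · rw [Finset.sum_eq_single (m + Finsupp.single i n)]
    · rw [if_pos]
      ext j
      by_cases hj : j = i
      · subst hj; simp [h]
      · simp [Finsupp.erase_ne hj]
    · intro m' hm' hne
      rw [if_neg]
      rintro rfl
      apply hne
      rw [Finset.mem_filter] at hm'
      rw [← hm'.2, Finsupp.erase_add_single]
    · intro hm
      simp only [Finset.mem_filter, mem_support_iff, Finsupp.add_apply, Finsupp.single_eq_same, h,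
        zero_add, and_true, not_not] at hm
      simp [hm]
  · refine Finset.sum_eq_zero fun m' _ => if_neg ?_
    rintro rfl
    simp at h

theorem coeff_mul_X_pow_eq (i : σ) (n : ℕ) (f : MvPolynomial σ K) (m : σ →₀ ℕ) :
    coeff m (f * X i ^ n) = if n ≤ m i then coeff (m - Finsupp.single i n) f else 0 := by
  classical
  rw [X_pow_eq_monomial, coeff_mul_monomial', mul_one]
  simp [Finsupp.single_le_iff]

theorem degreeOf_coeffIn_le (i j : σ) (n : ℕ) (f : MvPolynomial σ K) :
    (coeffIn i n f).degreeOf j ≤ f.degreeOf j := by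
  rw [degreeOf_le_iff]
  intro m hm
  rw [mem_support_iff, coeff_coeffIn] at hm
  split_ifs at hm with h
  · exact (Nat.le_add_right _ _).trans (degreeOf_le_iff.1 le_rfl _ (mem_support_iff.2 hm))
  · exact absurd rfl hm

@[simp]
theorem degreeOf_coeffIn_self (i : σ) (n : ℕ) (f : MvPolynomial σ K) :
    (coeffIn i n f).degreeOf i = 0 := by
  rw [← Nat.le_zero, degreeOf_le_iff]
  intro m hm
  rw [mem_support_iff, coeff_coeffIn] at hm
  split_ifs at hm with h
  · exact h.le
  · exact absurd rfl hm

theorem coeffIn_mem_supported {s : Set σ} {f : MvPolynomial σ K} (hf : f ∈ supported K s) (i : σ)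
    (n : ℕ) : coeffIn i n f ∈ supported K (s \ {i}) := by
  rw [mem_supported_iff_forall_degreeOf] at hf ⊢
  intro j hj
  by_cases h : j = i
  · subst h; simp
  · exact Nat.le_zero.1 ((degreeOf_coeffIn_le i j n f).trans (hf j fun hs => hj ⟨hs, h⟩).le)

theorem coeffIn_add (i : σ) (n : ℕ) (f g : MvPolynomial σ K) :
    coeffIn i n (f + g) = coeffIn i n f + coeffIn i n g := by
  ext m
  simp only [coeff_add, coeff_coeffIn]
  split_ifs <;> simp

theorem coeffIn_eq_zero {i : σ} {n : ℕ} {f : MvPolynomial σ K} (h : f.degreeOf i < n) :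
    coeffIn i n f = 0 := by
  ext m
  rw [coeff_coeffIn, coeff_zero]
  split_ifs with hm
  · by_contra h0
    have := degreeOf_le_iff.1 (le_refl (f.degreeOf i)) _ (mem_support_iff.2 h0)
    simp at this
    omega
  · rfl

theorem coeffIn_mul_X_pow_self {i : σ} {f : MvPolynomial σ K} (hf : f.degreeOf i = 0) (n : ℕ) :
    coeffIn i n (f * X i ^ n) = f := by
  ext m
  rw [coeff_coeffIn, coeff_mul_X_pow_eq]
  split_ifs with h1 h2
  · simp
  · simp at h2
  · by_contra h0
    have := degreeOf_le_iff.1 hf.le _ (mem_support_iff.2 (Ne.symm h0))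
    omega

theorem coeff_truncIn (i : σ) (j : ℕ) (f : MvPolynomial σ K) (m : σ →₀ ℕ) :
    coeff m (truncIn i j f) = if m i ≤ j then coeff m f else 0 := by
  classical
  rw [truncIn, coeff_sum]
  simp only [coeff_mul_X_pow_eq, coeff_coeffIn]
  have key : ∀ n ∈ Finset.range (j + 1), n ≠ m i →
      (if n ≤ m i then if (m - Finsupp.single i n) i = 0 then
        coeff (m - Finsupp.single i n + Finsupp.single i n) f else 0 else 0) = 0 := by
    intro n _ hn
    split_ifs with h1 h2
    · simp at h2; omega
    · rfl
    · rfl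
  split_ifs with h
  · rw [Finset.sum_eq_single_of_mem (m i) (by simp; omega) key]
    rw [if_pos le_rfl, if_pos (by simp)]
    congr 1
    exact tsub_add_cancel_of_le (Finsupp.single_le_iff.2 le_rfl)
  · exact Finset.sum_eq_zero fun n hn => key n hn (by simp at hn; omega)

theorem truncIn_eq_self {i : σ} {j : ℕ} {f : MvPolynomial σ K} (h : f.degreeOf i ≤ j) :
    truncIn i j f = f := by
  ext m
  rw [coeff_truncIn]
  split_ifs with hm
  · rfl
  · by_contra h0
    exact hm ((degreeOf_le_iff.1 le_rfl _ (mem_support_iff.2 (Ne.symm h0))).trans h)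

theorem degreeOf_truncIn_le (i : σ) (j : ℕ) (f : MvPolynomial σ K) :
    (truncIn i j f).degreeOf i ≤ j := by
  rw [degreeOf_le_iff]
  intro m hm
  rw [mem_support_iff, coeff_truncIn] at hm
  by_contra h
  exact hm (if_neg h)

theorem truncIn_mem_supported {s : Set σ} {f : MvPolynomial σ K} (hf : f ∈ supported K s) (i : σ)
    (j : ℕ) : truncIn i j f ∈ supported K s := by
  rw [mem_supported_iff_forall_degreeOf] at hf ⊢
  intro l hl
  rw [← Nat.le_zero, degreeOf_le_iff]
  intro m hm
  rw [mem_support_iff, coeff_truncIn] at hm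
  refine (degreeOf_le_iff.1 (hf l hl).le m (mem_support_iff.2 fun h => hm ?_))
  simp [h]

theorem truncIn_succ (i : σ) (j : ℕ) (f : MvPolynomial σ K) :
    truncIn i (j + 1) f = truncIn i j f + coeffIn i (j + 1) f * X i ^ (j + 1) :=
  Finset.sum_range_succ _ _

theorem degreeOf_mul_X_pow_add {i : σ} {h c : MvPolynomial σ K} {d : ℕ} (h0 : h ≠ 0)
    (hh : h.degreeOf i = 0) (hc : c.degreeOf i < d) : (h * X i ^ d + c).degreeOf i = d := by
  have := degreeOf_mul_X_self_pow_eq_add_of_ne_zero i d h0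
  rw [hh, zero_add] at this
  rw [degreeOf_add_eq_of_degreeOf_lt (by rwa [this]), this]

theorem leadCoeffIn_mul_X_pow_add {i : σ} {h c : MvPolynomial σ K} {d : ℕ} (h0 : h ≠ 0)
    (hh : h.degreeOf i = 0) (hc : c.degreeOf i < d) : leadCoeffIn i (h * X i ^ d + c) = h := by
  rw [leadCoeffIn, degreeOf_mul_X_pow_add h0 hh hc, coeffIn_add, coeffIn_mul_X_pow_self hh,
    coeffIn_eq_zero hc, add_zero]

theorem exists_apply_eq_degreeOf (i : σ) {f : MvPolynomial σ K} (hf : f ≠ 0) :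
    ∃ m ∈ f.support, m i = f.degreeOf i := by
  obtain ⟨m, hm, h⟩ := Finset.exists_mem_eq_sup f.support (support_nonempty.2 hf) fun m => m i
  exact ⟨m, hm, by rw [degreeOf_eq_sup, h]⟩

theorem leadCoeffIn_ne_zero (i : σ) {f : MvPolynomial σ K} (hf : f ≠ 0) :
    leadCoeffIn i f ≠ 0 := by
  obtain ⟨m, hm, h⟩ := exists_apply_eq_degreeOf i hf
  intro h0
  have := congr_arg (coeff (m.erase i)) h0
  rw [leadCoeffIn, coeff_coeffIn, if_pos (by simp), ← h, Finsupp.erase_add_single,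
    coeff_zero] at this
  exact mem_support_iff.1 hm this

theorem eq_leadCoeffIn_mul_add {i : σ} {f : MvPolynomial σ K} (hf : 0 < f.degreeOf i) :
    f = leadCoeffIn i f * X i ^ f.degreeOf i + truncIn i (f.degreeOf i - 1) f := by
  obtain ⟨d, hd⟩ : ∃ d, f.degreeOf i = d + 1 := ⟨f.degreeOf i - 1, by omega⟩
  conv_lhs => rw [← truncIn_eq_self hd.le, truncIn_succ]
  rw [leadCoeffIn, hd, Nat.add_sub_cancel, add_comm]

theorem degreeOf_truncIn {i : σ} {j : ℕ} {f : MvPolynomial σ K} (hj : coeffIn i j f ≠ 0) :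
    (truncIn i j f).degreeOf i = j := by
  cases j with
  | zero => exact Nat.le_zero.1 (degreeOf_truncIn_le i 0 f)
  | succ j =>
    rw [truncIn_succ, add_comm, degreeOf_mul_X_pow_add hj (by simp)
      (Nat.lt_succ_of_le (degreeOf_truncIn_le i j f))]

theorem leadCoeffIn_truncIn {i : σ} {j : ℕ} {f : MvPolynomial σ K} (hj : coeffIn i j f ≠ 0) :
    leadCoeffIn i (truncIn i j f) = coeffIn i j f := by
  rw [leadCoeffIn, degreeOf_truncIn hj]
  ext m
  simp only [coeff_coeffIn, coeff_truncIn]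
  split_ifs with h1 h2
  · rfl
  · simp [h1] at h2
  · rfl

theorem hasMainVar_iff [LinearOrder σ] {f : MvPolynomial σ K} {i : σ} :
    HasMainVar f i ↔ f ∈ supported K (Set.Ici i) ∧ 0 < f.degreeOf i := by
  refine and_congr_right fun h => ?_
  rw [mem_supported_iff_forall_degreeOf] at h
  rw [mem_supported_iff_forall_degreeOf]
  constructor
  · intro hn
    by_contra h0
    apply hn
    intro j hj
    rcases eq_or_lt_of_le (not_lt.1 hj) with rfl | hlt
    · omega
    · exact h j (by simpa using hlt)
  · intro hpos hn
    exact hpos.ne' (hn i (by simp))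

theorem HasMainVar.unique [LinearOrder σ] {f : MvPolynomial σ K} {i j : σ} (hi : HasMainVar f i)
    (hj : HasMainVar f j) : i = j := by
  wlog h : i < j generalizing i j
  · rcases eq_or_lt_of_le (not_lt.1 h) with rfl | hlt
    · rfl
    · exact (this hj hi hlt).symm
  · have := mem_supported_iff_forall_degreeOf.1 hj.1 i (by simpa using h)
    have := (hasMainVar_iff.1 hi).2
    omega

theorem HasMainVar.leadCoeffIn_mem [LinearOrder σ] {f : MvPolynomial σ K} {i : σ}
    (hi : HasMainVar f i) : leadCoeffIn i f ∈ supported K (Set.Ioi i) :=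
  supported_mono (fun _ hj => lt_of_le_of_ne hj.1 (Ne.symm hj.2))
    (coeffIn_mem_supported hi.1 i _)

end Coefficients

/-! ### The well-founded order on systems -/

section Termination

open scoped MonomialOrder

open MonomialOrder (lex)

theorem isDershowitzMannaLT_val {α : Type*} [LinearOrder α] {A B : Finset α} {m : α} (hB : m ∈ B)
    (hA : m ∉ A) (h : ∀ a ∈ A, a ∈ B ∨ a < m) : Multiset.IsDershowitzMannaLT A.val B.val := by
  refine ⟨(A ∩ B).val, (A \ B).val, (B \ A).val, ?_, ?_, ?_, ?_⟩
  · intro h0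
    have : m ∈ (B \ A).val := Finset.mem_sdiff.2 ⟨hB, hA⟩
    rw [h0] at this
    simp at this
  · rw [add_comm, Finset.sdiff_val, Finset.inter_val, Multiset.sub_add_inter]
  · rw [add_comm, Finset.sdiff_val, Finset.inter_comm, Finset.inter_val, Multiset.sub_add_inter]
  · intro a ha
    have ha' := Finset.mem_sdiff.1 (Finset.mem_def.2 ha)
    exact ⟨m, Finset.mem_sdiff.2 ⟨hB, hA⟩, (h a ha'.1).resolve_left ha'.2⟩

/-- The well-founded relation on polynomials that compares the supports, as multisets of
monomials. -/
def SupportLT {σ R : Type*} [CommSemiring R] (m : MonomialOrder σ) (f g : MvPolynomial σ R) :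
    Prop :=
  Multiset.IsDershowitzMannaLT (f.support.map m.toSyn.toEquiv.toEmbedding).val
    (g.support.map m.toSyn.toEquiv.toEmbedding).val

theorem wellFounded_supportLT {σ R : Type*} [CommSemiring R] (m : MonomialOrder σ) :
    WellFounded (SupportLT (R := R) m) :=
  InvImage.wf _ Multiset.wellFounded_isDershowitzMannaLT

theorem SupportLT.of_mem {σ R : Type*} [CommSemiring R] {m : MonomialOrder σ}
    {f g : MvPolynomial σ R} {a : σ →₀ ℕ} (hg : a ∈ g.support) (hf : a ∉ f.support)
    (h : ∀ b ∈ f.support, b ∈ g.support ∨ b ≺[m] a) : SupportLT m f g := by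
  refine isDershowitzMannaLT_val (m := m.toSyn a) (by simpa using hg) (by simpa using hf) ?_
  intro b hb
  obtain ⟨c, hc, rfl⟩ := Finset.mem_map.1 hb
  exact (h c hc).imp (fun h => Finset.mem_map_of_mem _ h) id

variable {r : ℕ} {K : Type*} [Field K]

/-- The sum of the degrees in the variable with (zero-based) index `k`. -/
noncomputable def degreeSum (k : ℕ) (F : Finset (MvPolynomial (Fin r) K)) : ℕ :=
  ∑ f ∈ F, if h : k < r then f.degreeOf ⟨k, h⟩ else 0

/-- The monomial ideal generated by the leading monomials of the nonzero members of `F`. -/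
noncomputable def initialIdeal (F : Finset (MvPolynomial (Fin r) K)) :
    Ideal (MvPolynomial (Fin r) K) :=
  Ideal.span ((fun m => monomial m (1 : K)) '' {m | ∃ h ∈ F, h ≠ 0 ∧ lex.degree h = m})

/-- The well-founded relation on systems that shows termination. -/
def SystemLT : System r K → System r K → Prop :=
  InvImage (Prod.Lex (· < ·) (Prod.Lex (· < ·)
    (Prod.Lex (· > ·) (Relation.CutExpand (SupportLT lex)))))
    fun S => (r - S.k, degreeSum S.k S.unsorted, initialIdeal S.unsorted, S.unsorted.val)

/-- The degree sum precedes the initial ideal because replacing `f` by a pseudo-remainder may shrink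
that ideal. Increasing chains of ideals stop since the polynomial ring is noetherian. -/
theorem wellFounded_systemLT : WellFounded (SystemLT (r := r) (K := K)) := by
  have h1 : WellFounded (fun I J : Ideal (MvPolynomial (Fin r) K) => I > J) :=
    (inferInstance : WellFoundedGT (Ideal (MvPolynomial (Fin r) K))).wf
  exact InvImage.wf _ (WellFounded.prod_lex Nat.lt_wfRel.wf (WellFounded.prod_lex
    Nat.lt_wfRel.wf (WellFounded.prod_lex h1 (wellFounded_supportLT lex).cutExpand)))

theorem SystemLT.of_k {S' S : System r K} (h : S.k < S'.k) (hr : S.k < r) : SystemLT S' S :=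
  Prod.Lex.left _ _ (by omega)

theorem SystemLT.of_degreeSum {S' S : System r K} (hk : S'.k = S.k)
    (h : degreeSum S.k S'.unsorted < degreeSum S.k S.unsorted) : SystemLT S' S := by
  rw [SystemLT, InvImage, hk]
  exact Prod.Lex.right _ (Prod.Lex.left _ _ h)

theorem SystemLT.of_initialIdeal {S' S : System r K} (hk : S'.k = S.k)
    (h : degreeSum S.k S'.unsorted ≤ degreeSum S.k S.unsorted)
    (hI : initialIdeal S.unsorted < initialIdeal S'.unsorted) : SystemLT S' S := by
  rcases h.lt_or_eq with h | h
  · exact .of_degreeSum hk h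
  · rw [SystemLT, InvImage, hk, h]
    exact Prod.Lex.right _ (Prod.Lex.right _ (Prod.Lex.left _ _ hI))

theorem SystemLT.of_cutExpand {S' S : System r K} (hk : S'.k = S.k)
    (h : degreeSum S.k S'.unsorted ≤ degreeSum S.k S.unsorted)
    (hI : initialIdeal S.unsorted ≤ initialIdeal S'.unsorted)
    (hC : Relation.CutExpand (SupportLT lex) S'.unsorted.val S.unsorted.val) : SystemLT S' S := by
  rcases hI.lt_or_eq with hI | hI
  · exact .of_initialIdeal hk h hI
  rcases h.lt_or_eq with h | h
  · exact .of_degreeSum hk h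
  · rw [SystemLT, InvImage, hk, h, hI]
    exact Prod.Lex.right _ (Prod.Lex.right _ (Prod.Lex.right _ hC))

/-- Without variables before `T_i`, the lexicographic order compares exponents of `T_i` first. -/
theorem degreeOf_eq_lex_degree {i : Fin r} {h : MvPolynomial (Fin r) K}
    (hh : h ∈ supported K (Set.Ici i)) : h.degreeOf i = lex.degree h i := by
  rcases eq_or_ne h 0 with rfl | h0
  · simp
  have hd := lex.degree_mem_support h0
  refine le_antisymm (degreeOf_le_iff.2 fun m hm => ?_) (degreeOf_le_iff.1 le_rfl _ hd)
  by_contra! hlt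
  have hle := lex.le_degree hm
  refine absurd hle (not_le.2 ?_)
  rw [MonomialOrder.lex_lt_iff, Finsupp.Lex.lt_iff]
  refine ⟨i, fun j hj => ?_, hlt⟩
  have hj' : j ∉ Set.Ici i := by simpa using hj
  simp [apply_eq_zero_of_mem_supported hh hm hj', apply_eq_zero_of_mem_supported hh hd hj']

/-- The monomials of `h` of top degree in `T_i` are those of the leading coefficient times a fixed
power of `T_i`, and the leading monomial of `h` is among them. -/
theorem lex_degree_leadCoeffIn {i : Fin r} {h : MvPolynomial (Fin r) K}
    (hh : h ∈ supported K (Set.Ici i)) :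
    lex.degree (leadCoeffIn i h) = (lex.degree h).erase i := by
  rcases eq_or_ne h 0 with rfl | h0
  · have : leadCoeffIn i (0 : MvPolynomial (Fin r) K) = 0 := by simp [leadCoeffIn, coeffIn]
    simp [this]
  have hd := lex.degree_mem_support h0
  have hb := lex.degree_mem_support (leadCoeffIn_ne_zero i h0)
  apply lex.toSyn.injective
  apply le_antisymm
  · rw [mem_support_iff, leadCoeffIn, coeff_coeffIn] at hb
    split_ifs at hb with hi
    · have := lex.le_degree (mem_support_iff.2 hb)
      rw [degreeOf_eq_lex_degree hh] at this
      conv_rhs at this => rw [← Finsupp.erase_add_single i (lex.degree h)]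
      rw [map_add, map_add] at this
      simpa only [leadCoeffIn, degreeOf_eq_lex_degree hh] using le_of_add_le_add_right this
    · exact absurd rfl hb
  · apply lex.le_degree
    rw [mem_support_iff, leadCoeffIn, coeff_coeffIn, if_pos (by simp), degreeOf_eq_lex_degree hh,
      Finsupp.erase_add_single]
    exact mem_support_iff.1 hd

theorem monomial_mem_initialIdeal {F : Finset (MvPolynomial (Fin r) K)} {m : Fin r →₀ ℕ} :
    monomial m (1 : K) ∈ initialIdeal F ↔ ∃ h ∈ F, h ≠ 0 ∧ lex.degree h ≤ m := by
  classical
  rw [initialIdeal, mem_ideal_span_monomial_image]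
  simp only [support_monomial, one_ne_zero, if_false, Finset.mem_singleton, forall_eq,
    Set.mem_ofPred_eq]
  constructor
  · rintro ⟨_, ⟨h, hF, h0, rfl⟩, hle⟩
    exact ⟨h, hF, h0, hle⟩
  · rintro ⟨h, hF, h0, hle⟩
    exact ⟨_, ⟨h, hF, h0, rfl⟩, hle⟩

theorem initialIdeal_le_iff {F G : Finset (MvPolynomial (Fin r) K)} :
    initialIdeal F ≤ initialIdeal G ↔
      ∀ f ∈ F, f ≠ 0 → ∃ g ∈ G, g ≠ 0 ∧ lex.degree g ≤ lex.degree f := by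
  conv_lhs => rw [initialIdeal, Ideal.span_le]
  constructor
  · intro h f hf h0
    exact monomial_mem_initialIdeal.1 (h ⟨_, ⟨f, hf, h0, rfl⟩, rfl⟩)
  · rintro h _ ⟨_, ⟨f, hf, h0, rfl⟩, rfl⟩
    exact monomial_mem_initialIdeal.2 (h f hf h0)

/-- The polynomial by which `f` is replaced when its term with exponent `m` is cancelled by a
multiple of `h`. -/
noncomputable def cancelTerm (f h : MvPolynomial (Fin r) K) (m : Fin r →₀ ℕ) :
    MvPolynomial (Fin r) K :=
  f - monomial (m - lex.degree h) (f.coeff m / lex.leadingCoeff h) * h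

section CancelTerm

variable {f h : MvPolynomial (Fin r) K} {m : Fin r →₀ ℕ}

theorem coeff_cancelTerm_self (h0 : h ≠ 0) (hdvd : lex.degree h ≤ m) :
    (cancelTerm f h m).coeff m = 0 := by
  rw [cancelTerm, coeff_sub, coeff_monomial_mul', if_pos (tsub_le_self),
    tsub_tsub_cancel_of_le hdvd]
  have : coeff (lex.degree h) h ≠ 0 := lex.coeff_degree_ne_zero_iff.2 h0
  rw [MonomialOrder.leadingCoeff, div_mul_cancel₀ _ this, sub_self]

theorem mem_support_cancelTerm {n : Fin r →₀ ℕ} (hn : n ∈ (cancelTerm f h m).support) :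
    n ∈ f.support ∨ m - lex.degree h ≤ n ∧ n - (m - lex.degree h) ∈ h.support := by
  by_contra! hc
  rw [mem_support_iff, cancelTerm, coeff_sub, coeff_monomial_mul', notMem_support_iff.1 hc.1] at hn
  split_ifs at hn with hle
  · exact hn (by simp [notMem_support_iff.1 (hc.2 hle)])
  · simp at hn

/-- The subtracted multiple of `h` has leading monomial `m`, so `m` disappears and only monomials
below `m` can enter. -/
theorem supportLT_cancelTerm (h0 : h ≠ 0) (hm : m ∈ f.support) (hdvd : lex.degree h ≤ m) :
    SupportLT lex (cancelTerm f h m) f := by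
  have hself : m ∉ (cancelTerm f h m).support :=
    notMem_support_iff.2 (coeff_cancelTerm_self h0 hdvd)
  refine .of_mem hm hself fun n hn => (mem_support_cancelTerm hn).imp_right ?_
  rintro ⟨hle, hn'⟩
  have h1 := add_le_add_left (lex.le_degree hn') (lex.toSyn (m - lex.degree h))
  rw [← map_add, ← map_add, tsub_add_cancel_of_le hle, add_tsub_cancel_of_le hdvd] at h1
  refine lt_of_le_of_ne h1 fun h2 => ?_
  rw [lex.toSyn.injective h2] at hn
  exact hself hn

/-- The leading monomial of `h` already attains its degree in `T_i`, so no monomial of the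
subtracted multiple exceeds `m` in that variable. -/
theorem degreeOf_cancelTerm_le {i : Fin r} (hh : h ∈ supported K (Set.Ici i)) (hm : m ∈ f.support)
    (hdvd : lex.degree h ≤ m) : (cancelTerm f h m).degreeOf i ≤ f.degreeOf i := by
  rw [degreeOf_le_iff]
  intro n hn
  rcases mem_support_cancelTerm hn with hn | ⟨hle, hn⟩
  · exact degreeOf_le_iff.1 le_rfl _ hn
  · have h1 := degreeOf_le_iff.1 (degreeOf_eq_lex_degree hh).le _ hn
    have h2 := degreeOf_le_iff.1 (le_refl (f.degreeOf i)) _ hm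
    have h3 := hle i
    have h4 := hdvd i
    simp only [Finsupp.coe_tsub, Pi.sub_apply] at h1 h3
    omega

end CancelTerm

end Termination

/-! ### Every operation on a system lowers it -/

section Decrease

open scoped MonomialOrder

open MonomialOrder (lex)

variable {r : ℕ} {K : Type*} [Field K]

/-- All monomials of the subtracted multiple are at most `m`, hence strictly below the leading
monomial of `f`. -/
theorem lex_degree_cancelTerm {f h : MvPolynomial (Fin r) K} {m : Fin r →₀ ℕ}
    (hm : m ∈ f.support) (hdvd : lex.degree h ≤ m) (hne : m ≠ lex.degree f) :
    cancelTerm f h m ≠ 0 ∧ lex.degree (cancelTerm f h m) = lex.degree f := by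
  have hf : f ≠ 0 := by rintro rfl; simp at hm
  have hlt : m ≺[lex] lex.degree f :=
    lt_of_le_of_ne (lex.le_degree hm) fun h => hne (lex.toSyn.injective h)
  have hle : ∀ n, m - lex.degree h ≤ n → n - (m - lex.degree h) ∈ h.support → n ≼[lex] m := by
    intro n hle hn
    have h1 := add_le_add_left (lex.le_degree hn) (lex.toSyn (m - lex.degree h))
    rwa [← map_add, ← map_add, tsub_add_cancel_of_le hle, add_tsub_cancel_of_le hdvd] at h1
  have hmem : lex.degree f ∈ (cancelTerm f h m).support := by
    rw [mem_support_iff, cancelTerm, coeff_sub, coeff_monomial_mul']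
    split_ifs with h1
    · by_cases h2 : lex.degree f - (m - lex.degree h) ∈ h.support
      · exact absurd hlt (not_lt.2 (hle _ h1 h2))
      · rw [notMem_support_iff.1 h2, mul_zero, sub_zero]
        exact lex.coeff_degree_ne_zero_iff.2 hf
    · rw [sub_zero]
      exact lex.coeff_degree_ne_zero_iff.2 hf
  refine ⟨by rintro h0; simp [h0] at hmem,
    lex.toSyn.injective (le_antisymm ?_ (lex.le_degree hmem))⟩
  rw [lex.degree_le_iff]
  intro n hn
  rcases mem_support_cancelTerm hn with hn | ⟨h1, h2⟩
  · exact lex.le_degree hn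
  · exact (hle n h1 h2).trans hlt.le

theorem mem_supported_Ici {k : ℕ} (hk : k < r) {f : MvPolynomial (Fin r) K} :
    f ∈ supported K (Set.Ici (⟨k, hk⟩ : Fin r)) ↔ f ∈ supported K {i : Fin r | k ≤ (i : ℕ)} := by
  have : Set.Ici (⟨k, hk⟩ : Fin r) = {i : Fin r | k ≤ (i : ℕ)} := by ext; simp [Fin.le_def]
  rw [this]

theorem mem_supported_iff_free {k : ℕ} {f : MvPolynomial (Fin r) K} :
    f ∈ supported K {i : Fin r | k ≤ (i : ℕ)} ↔ ∀ i : Fin r, (i : ℕ) < k → f.degreeOf i = 0 := by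
  rw [mem_supported_iff_forall_degreeOf]
  simp

/-- Only an inequality holds, since `u` may already belong to the set. The additive form avoids
truncated subtraction. -/
theorem degreeSum_insert_erase_add_le [DecidableEq (MvPolynomial (Fin r) K)] (k : ℕ) (hk : k < r)
    {F : Finset (MvPolynomial (Fin r) K)}
    {f u : MvPolynomial (Fin r) K} (hf : f ∈ F) :
    degreeSum k (insert u (F.erase f)) + f.degreeOf ⟨k, hk⟩ ≤
      degreeSum k F + u.degreeOf ⟨k, hk⟩ := by
  simp only [degreeSum, hk, dif_pos]
  rw [← Finset.sum_erase_add _ _ hf]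
  by_cases hu : u ∈ F.erase f
  · rw [Finset.insert_eq_of_mem hu]
    omega
  · rw [Finset.sum_insert hu]
    omega

theorem cutExpand_insert_erase {α : Type*} [DecidableEq α] {R : α → α → Prop} {F : Finset α}
    {f u : α}
    (hf : f ∈ F) (h : R u f) : Relation.CutExpand R (insert u (F.erase f)).val F.val := by
  have hF : F.val = (F.erase f).val + {f} := by
    rw [Finset.erase_val, add_comm, Multiset.singleton_add, Multiset.cons_erase hf]
  by_cases hu : u ∈ F.erase f
  · exact ⟨0, f, by simp, by rw [Finset.insert_eq_of_mem hu, add_zero, ← hF]⟩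
  · refine ⟨{u}, f, by simpa using h, ?_⟩
    rw [Finset.insert_val_of_notMem hu, ← Multiset.singleton_add, add_assoc, ← hF, add_comm]

theorem SystemLT.of_reduceStep {S : System r K} {F : Finset (MvPolynomial (Fin r) K)}
    (hk : S.k < r) (hS : ∀ f ∈ S.unsorted, f ∈ supported K {i : Fin r | S.k ≤ (i : ℕ)})
    (hF : ReduceStep S.unsorted F) : SystemLT ⟨F, S.sorted, S.k, S.ineq⟩ S := by
  classical
  cases hF with
  | dropZero h0 =>
    refine .of_cutExpand rfl (Finset.sum_le_sum_of_subset (Finset.erase_subset _ _)) ?_ ?_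
    · rw [initialIdeal_le_iff]
      exact fun f hf h0 => ⟨f, Finset.mem_erase.2 ⟨h0, hf⟩, h0, le_rfl⟩
    · refine ⟨0, 0, by simp, ?_⟩
      rw [Finset.erase_val, add_comm, Multiset.singleton_add, add_zero, Multiset.cons_erase h0]
  | divide f h hf hh hfh h0 m hm hdvd =>
    refine .of_cutExpand rfl ?_ ?_
      (cutExpand_insert_erase hf (supportLT_cancelTerm h0 hm hdvd))
    · have h1 := degreeSum_insert_erase_add_le (u := cancelTerm f h m) S.k hk hf
      have h2 := degreeOf_cancelTerm_le ((mem_supported_Ici hk).2 (hS h hh)) hm hdvd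
      simp only [cancelTerm] at h1 h2
      dsimp only
      omega
    · rw [initialIdeal_le_iff]
      intro g hg hg0
      have hhmem : h ∈ S.unsorted.erase f := Finset.mem_erase.2 ⟨hfh, hh⟩
      by_cases hgf : g = f
      · subst hgf
        -- If the leading term itself is cancelled, `h` takes over the role of `g` in the initial
        -- ideal; otherwise the leading monomial survives.
        by_cases hme : m = lex.degree g
        · exact ⟨h, Finset.mem_insert_of_mem hhmem, h0, hme ▸ hdvd⟩
        · obtain ⟨h1, h2⟩ := lex_degree_cancelTerm hm hdvd hme
          exact ⟨_, Finset.mem_insert_self _ _, h1, h2.le⟩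
      · exact ⟨g, Finset.mem_insert_of_mem (Finset.mem_erase.2 ⟨hgf, hg⟩), hg0, le_rfl⟩

/-- The only branch in which neither `k` nor the degree sum settles the matter adjoins the leading
coefficient `b` of `h`. There interreducedness makes the leading monomial of `b` new to the initial
ideal. -/
theorem SystemLT.of_expand {S S' : System r K} {N : Multiset (System r K)}
    (hS : ∀ f ∈ S.unsorted, f ∈ supported K {i : Fin r | S.k ≤ (i : ℕ)})
    (hred : Interreduced S.unsorted) (hN : Expand S N) (hS' : S' ∈ N) : SystemLT S' S := by
  classical
  cases hN with
  | pseudoDivide hk f h hf hh hne hpos hdeg j a u ha hu heq hlt =>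
    simp only [Multiset.insert_eq_cons, Multiset.mem_cons, Multiset.mem_singleton] at hS'
    rcases hS' with rfl | rfl
    · refine .of_degreeSum rfl ?_
      have h1 := degreeSum_insert_erase_add_le (u := u) S.k hk hf
      dsimp only
      omega
    · have hhs := (mem_supported_Ici hk).2 (hS h hh)
      have h0 : h ≠ 0 := by rintro rfl; simp at hpos
      have hb := leadCoeffIn_ne_zero ⟨S.k, hk⟩ h0
      have hdb := lex_degree_leadCoeffIn hhs
      refine .of_initialIdeal rfl ?_ ?_
      · simp only [degreeSum]
        by_cases hmem : leadCoeffIn ⟨S.k, hk⟩ h ∈ S.unsorted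
        · rw [Finset.insert_eq_of_mem hmem]
        · rw [Finset.sum_insert hmem]
          simp [hk, leadCoeffIn]
      · refine lt_of_le_not_ge ?_ ?_
        · exact initialIdeal_le_iff.2 fun g hg h0 => ⟨g, Finset.mem_insert_of_mem hg, h0, le_rfl⟩
        · rw [initialIdeal_le_iff]
          intro hc
          obtain ⟨g, hg, hg0, hle⟩ := hc _ (Finset.mem_insert_self _ _) hb
          rw [hdb] at hle
          -- The monomial of `b` is that of `h` with `T_(k+1)` removed. So `h` does not divide it,
          -- and any other divisor `g` would also divide the leading monomial of `h`.
          by_cases hgh : g = h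
          · subst hgh
            have := hle ⟨S.k, hk⟩
            rw [← degreeOf_eq_lex_degree hhs] at this
            simp at this
            omega
          · refine hred.2 g hg h hh hgh (hle.trans fun i => ?_)
            by_cases hi : i = ⟨S.k, hk⟩
            · subst hi; simp
            · rw [Finsupp.erase_ne hi]
  | lastPolynomial hk f hf hpos huniq =>
    refine .of_k ?_ hk
    rw [Multiset.mem_cons, Multiset.mem_map] at hS'
    rcases hS' with rfl | ⟨j, -, rfl⟩ <;> exact Nat.lt_succ_self _
  | unusedVariable hk hfree =>
    rw [Multiset.mem_singleton] at hS'
    subst hS'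
    exact .of_k (Nat.lt_succ_self _) hk

end Decrease

/-! ### Semi-triangularity is preserved, and the loop body is never stuck -/

section Invariance

open MonomialOrder (lex)

variable {r : ℕ} {K : Type*} [Field K]

theorem System.IsSemiTriangular.mem_supported {S : System r K} (hS : S.IsSemiTriangular) :
    ∀ f ∈ S.unsorted, f ∈ supported K {i : Fin r | S.k ≤ (i : ℕ)} :=
  fun f hf => mem_supported_iff_free.2 (hS.unsorted_free f hf)

theorem System.IsSemiTriangular.of_reduceStep {S : System r K} (hS : S.IsSemiTriangular)
    {F : Finset (MvPolynomial (Fin r) K)} (hF : ReduceStep S.unsorted F) :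
    (⟨F, S.sorted, S.k, S.ineq⟩ : System r K).IsSemiTriangular := by
  classical
  refine ⟨hS.k_le, hS.shape, hS.lead_dvd, hS.main_lt, ?_⟩
  dsimp only
  cases hF with
  | dropZero h0 => exact fun f hf => hS.unsorted_free f (Finset.mem_of_mem_erase hf)
  | divide f h hf hh hfh h0 m hm hdvd =>
    intro g hg
    rcases Finset.mem_insert.1 hg with rfl | hg
    · rw [← mem_supported_iff_free]
      refine sub_mem (hS.mem_supported f hf) (mul_mem ?_ (hS.mem_supported h hh))
      rw [mem_supported_iff_free]
      intro i hi
      refine Nat.le_zero.1 (degreeOf_le_iff.2 fun n hn => ?_)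
      rw [Finset.mem_singleton.1 (support_monomial_subset hn), Finsupp.coe_tsub, Pi.sub_apply,
        apply_eq_zero_of_mem_supported (hS.mem_supported f hf) hm (by simpa using hi)]
      simp
    · exact hS.unsorted_free g (Finset.mem_of_mem_erase hg)

theorem mem_supported_succ_of_degreeOf {k : ℕ} (hk : k < r) {f : MvPolynomial (Fin r) K}
    (hf : ∀ i : Fin r, (i : ℕ) < k → f.degreeOf i = 0) (h0 : f.degreeOf ⟨k, hk⟩ = 0) :
    ∀ i : Fin r, (i : ℕ) < k + 1 → f.degreeOf i = 0 := by
  intro i hi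
  rcases Nat.lt_succ_iff_lt_or_eq.1 hi with hi | hi
  · exact hf i hi
  · have : i = ⟨k, hk⟩ := Fin.ext hi
    rwa [this]

theorem coeffIn_free {k : ℕ} {f : MvPolynomial (Fin r) K}
    (hf : ∀ i : Fin r, (i : ℕ) < k → f.degreeOf i = 0) (j : Fin r) (n : ℕ) :
    ∀ i : Fin r, (i : ℕ) < k → (coeffIn j n f).degreeOf i = 0 :=
  fun i hi => Nat.le_zero.1 ((degreeOf_coeffIn_le j i n f).trans (hf i hi).le)

theorem System.IsSemiTriangular.of_expand {S : System r K} (hS : S.IsSemiTriangular)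
    {N : Multiset (System r K)} (hN : Expand S N) : ∀ S' ∈ N, S'.IsSemiTriangular := by
  classical
  intro S' hS'
  cases hN with
  | pseudoDivide hk f h hf hh hne hpos hdeg j a u ha hu heq hlt =>
    simp only [Multiset.insert_eq_cons, Multiset.mem_cons, Multiset.mem_singleton] at hS'
    rcases hS' with rfl | rfl
    · refine ⟨hS.k_le, hS.shape, fun f hf i hi => dvd_mul_of_dvd_right (hS.lead_dvd f hf i hi) _,
        hS.main_lt, fun g hg => ?_⟩
      rcases Finset.mem_insert.1 hg with rfl | hg
      · exact mem_supported_iff_free.1 hu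
      · exact hS.unsorted_free g (Finset.mem_of_mem_erase hg)
    · refine ⟨hS.k_le, hS.shape, hS.lead_dvd, hS.main_lt, fun g hg => ?_⟩
      rcases Finset.mem_insert.1 hg with rfl | hg
      · exact coeffIn_free (hS.unsorted_free h hh) _ _
      · exact hS.unsorted_free g hg
  | lastPolynomial hk f hf hpos huniq =>
    have hcoeff : ∀ i : ℕ, ∀ l : Fin r, (l : ℕ) < S.k + 1 →
        (coeffIn ⟨S.k, hk⟩ i f).degreeOf l = 0 := fun i =>
      mem_supported_succ_of_degreeOf hk (coeffIn_free (hS.unsorted_free f hf) _ _) (by simp)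
    have hfree : ∀ s : Finset ℕ, ∀ g ∈ S.unsorted.erase f ∪
        s.image (fun i => coeffIn ⟨S.k, hk⟩ i f), ∀ i : Fin r, (i : ℕ) < S.k + 1 →
        g.degreeOf i = 0 := by
      intro s g hg
      rcases Finset.mem_union.1 hg with hg | hg
      · have hg' := Finset.mem_erase.1 hg
        exact mem_supported_succ_of_degreeOf hk (hS.unsorted_free g hg'.2) (huniq g hg'.2 hg'.1)
      · obtain ⟨i, -, rfl⟩ := Finset.mem_image.1 hg
        exact hcoeff i
    rw [Multiset.mem_cons, Multiset.mem_map] at hS'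
    rcases hS' with rfl | ⟨j, hj, rfl⟩
    · refine ⟨hk, hS.shape, hS.lead_dvd,
        fun f hf i hi => (hS.main_lt f hf i hi).trans (Nat.lt_succ_self _), ?_⟩
      convert! hfree _
    · have hj' := Finset.mem_filter.1 (Finset.mem_def.2 hj)
      have hj1 := (Finset.mem_Icc.1 hj'.1).1
      have hmain : HasMainVar (truncIn ⟨S.k, hk⟩ j f) ⟨S.k, hk⟩ := by
        rw [hasMainVar_iff, degreeOf_truncIn hj'.2]
        exact ⟨truncIn_mem_supported ((mem_supported_Ici hk).2 (hS.mem_supported f hf)) _ _, hj1⟩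
      -- The main variables present so far come strictly before `T_(k+1)`, so the new polynomial
      -- cannot collide with them.
      have hnot : ∀ g ∈ S.sorted, ¬ HasMainVar g ⟨S.k, hk⟩ := fun g hg h =>
        lt_irrefl _ (hS.main_lt g hg _ h)
      refine ⟨hk, ⟨?_, ?_⟩, ?_, ?_, ?_⟩
      · intro g hg
        rcases Finset.mem_insert.1 hg with rfl | hg
        · exact ⟨_, hmain⟩
        · exact hS.shape.1 g hg
      · intro g hg g' hg' i hi hi'
        rcases Finset.mem_insert.1 hg with rfl | hg <;>
          rcases Finset.mem_insert.1 hg' with rfl | hg'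
        · rfl
        · exact absurd (hi.unique hmain ▸ hi') (hnot g' hg')
        · exact absurd (hi'.unique hmain ▸ hi) (hnot g hg)
        · exact hS.shape.2 g hg g' hg' i hi hi'
      · intro g hg i hi
        rcases Finset.mem_insert.1 hg with rfl | hg
        · rw [hi.unique hmain, leadCoeffIn_truncIn hj'.2]
          exact dvd_mul_left _ _
        · exact dvd_mul_of_dvd_left (hS.lead_dvd g hg i hi) _
      · intro g hg i hi
        rcases Finset.mem_insert.1 hg with rfl | hg
        · rw [hi.unique hmain]
          exact Nat.lt_succ_self _
        · exact (hS.main_lt g hg i hi).trans (Nat.lt_succ_self _)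
      · convert! hfree _
  | unusedVariable hk hfree =>
    rw [Multiset.mem_singleton] at hS'
    subst hS'
    exact ⟨hk, hS.shape, hS.lead_dvd,
      fun f hf i hi => (hS.main_lt f hf i hi).trans (Nat.lt_succ_self _),
      fun g hg => mem_supported_succ_of_degreeOf hk (hS.unsorted_free g hg) (hfree g hg)⟩

theorem System.IsSemiTriangular.isTriangular {S : System r K} (hS : S.IsSemiTriangular)
    (hk : ¬ S.k < r) : S.IsTriangular := by
  refine ⟨hS, fun f hf => ?_⟩
  have h : f ∈ supported K (∅ : Set (Fin r)) := mem_supported_iff_forall_degreeOf.2 fun i _ =>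
    hS.unsorted_free f hf i (i.2.trans_le (not_lt.1 hk))
  rw [supported_empty, Algebra.mem_bot] at h
  exact h.imp fun c hc => hc.symm

theorem exists_reduceStep {F : Finset (MvPolynomial (Fin r) K)} (hF : ¬ Interreduced F) :
    ∃ G, ReduceStep F G := by
  by_cases h0 : 0 ∈ F
  · exact ⟨_, .dropZero h0⟩
  · rw [Interreduced] at hF
    push Not at hF
    obtain ⟨h, hh, f, hf, hne, hle⟩ := hF h0
    have hf0 : f ≠ 0 := fun h => h0 (h ▸ hf)
    exact ⟨_, .divide f h hf hh hne (fun h => h0 (h ▸ hh)) _ (lex.degree_mem_support hf0) hle⟩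

/-- Multiplying `f` by `b` and subtracting the suitable multiple of `h` cancels the leading term in
`T_i`. Induction on the degree finishes. -/
theorem exists_pseudoDivision {i : Fin r} {s : Set (Fin r)} {h : MvPolynomial (Fin r) K}
    (hi : i ∈ s) (hh : h ∈ supported K s) (hpos : 0 < h.degreeOf i) (f : MvPolynomial (Fin r) K)
    (hf : f ∈ supported K s) :
    ∃ (j : ℕ) (a u : MvPolynomial (Fin r) K), a ∈ supported K s ∧ u ∈ supported K s ∧
      leadCoeffIn i h ^ j * f = a * h + u ∧ u.degreeOf i < h.degreeOf i := by
  induction hd : f.degreeOf i using Nat.strong_induction_on generalizing f with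
  | _ d ih =>
    subst hd
    by_cases hlt : f.degreeOf i < h.degreeOf i
    · exact ⟨0, 0, f, zero_mem _, hf, by simp, hlt⟩
    push Not at hlt
    have hlead : ∀ g ∈ supported K s, leadCoeffIn i g ∈ supported K s := fun g hg =>
      supported_mono Set.sdiff_subset (coeffIn_mem_supported hg i _)
    have hfe := eq_leadCoeffIn_mul_add (hpos.trans_le hlt)
    have hhe := eq_leadCoeffIn_mul_add hpos
    set df := f.degreeOf i
    set dh := h.degreeOf i
    set b := leadCoeffIn i h with hb
    set c := leadCoeffIn i f with hc
    set f0 := truncIn i (df - 1) f with hf0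
    set h0 := truncIn i (dh - 1) h with hh0
    have hXs : (X i : MvPolynomial (Fin r) K) ∈ supported K s := X_mem_supported.2 hi
    have hXd : ((X i : MvPolynomial (Fin r) K) ^ (df - dh)).degreeOf i = df - dh :=
      degreeOf_X_self_pow i _
    have hb0 : b.degreeOf i = 0 := degreeOf_coeffIn_self _ _ _
    have hc0 : c.degreeOf i = 0 := degreeOf_coeffIn_self _ _ _
    have hf0d : f0.degreeOf i ≤ df - 1 := degreeOf_truncIn_le _ _ _
    have hh0d : h0.degreeOf i ≤ dh - 1 := degreeOf_truncIn_le _ _ _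
    -- Both products have leading term `b * c * X i ^ df`; only the lower parts `f0` and `h0`
    -- remain.
    have heq : b * f - c * X i ^ (df - dh) * h = b * f0 - c * X i ^ (df - dh) * h0 := by
      have hX : (X i : MvPolynomial (Fin r) K) ^ df = X i ^ (df - dh) * X i ^ dh := by
        rw [← pow_add, Nat.sub_add_cancel hlt]
      calc b * f - c * X i ^ (df - dh) * h
          = b * (c * X i ^ df + f0) - c * X i ^ (df - dh) * (b * X i ^ dh + h0) := by
            rw [← hfe, ← hhe]
        _ = _ := by rw [hX]; ring
    have hlt' : (b * f - c * X i ^ (df - dh) * h).degreeOf i < df := by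
      rw [heq]
      refine (degreeOf_sub_le _ _ _).trans_lt (max_lt ?_ ?_)
      · have := degreeOf_mul_le i b f0
        omega
      · have h1 := degreeOf_mul_le i (c * X i ^ (df - dh)) h0
        have h2 := degreeOf_mul_le i c (X i ^ (df - dh))
        omega
    have hcs : c * X i ^ (df - dh) ∈ supported K s :=
      mul_mem (hlead f hf) (pow_mem hXs _)
    obtain ⟨j, a, u, ha, hu, he, hl⟩ := ih _ hlt' _
      (sub_mem (mul_mem (hlead h hh) hf) (mul_mem hcs hh)) rfl
    refine ⟨j + 1, a + b ^ j * (c * X i ^ (df - dh)), u,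
      add_mem ha (mul_mem (pow_mem (hlead h hh) _) hcs), hu, ?_, hl⟩
    linear_combination he

theorem exists_expand {S : System r K} (hS : S.IsSemiTriangular) (hk : S.k < r) :
    ∃ N, Expand S N := by
  by_cases h0 : ∀ f ∈ S.unsorted, f.degreeOf ⟨S.k, hk⟩ = 0
  · exact ⟨_, .unusedVariable hk h0⟩
  push Not at h0
  obtain ⟨f, hf, hfd⟩ := h0
  by_cases h1 : ∀ h ∈ S.unsorted, h ≠ f → h.degreeOf ⟨S.k, hk⟩ = 0
  · exact ⟨_, .lastPolynomial hk f hf (Nat.pos_of_ne_zero hfd) h1⟩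
  push Not at h1
  obtain ⟨h, hh, hne, hhd⟩ := h1
  wlog hle : h.degreeOf ⟨S.k, hk⟩ ≤ f.degreeOf ⟨S.k, hk⟩ generalizing f h
  · exact this h hh hhd f hf hne.symm hfd (le_of_not_ge hle)
  obtain ⟨j, a, u, ha, hu, heq, hlt⟩ := exists_pseudoDivision (i := ⟨S.k, hk⟩)
    (s := {i : Fin r | S.k ≤ (i : ℕ)}) (by simp) (hS.mem_supported h hh)
    (Nat.pos_of_ne_zero hhd) f (hS.mem_supported f hf)
  exact ⟨_, .pseudoDivide hk f h hf hh hne (Nat.pos_of_ne_zero hhd) hle j a u ha hu heq hlt⟩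

end Invariance

/-! ### Minimal polynomials by linear algebra -/

section MinimalPolynomialOutput

variable {L R : Type*} [Field L] [CommRing R] [Algebra L R]

theorem coeff_sum_C_mul_X_pow {d : ℕ} (q : Fin (d + 1) → L) (j : Fin (d + 1)) :
    (∑ j, Polynomial.C (q j) * Polynomial.X ^ (j : ℕ)).coeff (j : ℕ) = q j := by
  rw [Polynomial.finsetSum_coeff]
  simp only [Polynomial.coeff_C_mul_X_pow]
  simp [Fin.val_inj]

theorem natDegree_sum_C_mul_X_pow_le {d : ℕ} (q : Fin (d + 1) → L) :
    (∑ j, Polynomial.C (q j) * Polynomial.X ^ (j : ℕ)).natDegree ≤ d :=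
  Polynomial.natDegree_sum_le_of_forall_le _ _ fun j _ =>
    (Polynomial.natDegree_C_mul_X_pow_le _ _).trans (Nat.lt_succ_iff.1 j.2)

/-- The vector `M q` consists of the coordinates of `q(x)` in the basis `B`. -/
theorem mulVec_eq_zero_iff_aeval {d : ℕ} (B : Module.Basis (Fin d) L R) {x : R}
    {M : Matrix (Fin d) (Fin (d + 1)) L} (hM : ∀ i j, M i j = B.repr (x ^ (j : ℕ)) i)
    (q : Fin (d + 1) → L) : M.mulVec q = 0 ↔
      Polynomial.aeval x (∑ j, Polynomial.C (q j) * Polynomial.X ^ (j : ℕ)) = 0 := by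
  rw [← B.repr.map_eq_zero_iff, _root_.funext_iff, Finsupp.ext_iff]
  refine forall_congr' fun i => ?_
  simp only [Matrix.mulVec, dotProduct, hM, map_sum, map_mul, map_pow, Polynomial.aeval_C,
    Polynomial.aeval_X, ← Algebra.smul_def, map_smul, Finsupp.finsetSum_apply, Finsupp.smul_apply,
    smul_eq_mul, Pi.zero_apply, Finsupp.zero_apply]
  rw [Finset.sum_congr rfl fun j _ => mul_comm _ _]

theorem sum_coeff_mul_X_pow_fin {d : ℕ} {p : Polynomial L} (hp : p.natDegree ≤ d) :
    ∑ j : Fin (d + 1), Polynomial.C (p.coeff j) * Polynomial.X ^ (j : ℕ) = p := by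
  rw [Fin.sum_univ_eq_sum_range fun j => Polynomial.C (p.coeff j) * Polynomial.X ^ j]
  exact (p.as_sum_range_C_mul_X_pow' (Nat.lt_succ_of_le hp)).symm

theorem MinPolyOutput.ne_zero {x : R} {p : Polynomial L} (h : MinPolyOutput x p) : p ≠ 0 := by
  obtain ⟨d, B, M, q, hM, hq, hq0, hmin, rfl⟩ := h
  rintro h0
  apply hq0
  ext j
  rw [← coeff_sum_C_mul_X_pow q j, h0]
  simp

theorem MinPolyOutput.aeval_eq_zero {x : R} {p : Polynomial L} (h : MinPolyOutput x p) :
    Polynomial.aeval x p = 0 := by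
  obtain ⟨d, B, M, q, hM, hq, hq0, hmin, rfl⟩ := h
  exact (mulVec_eq_zero_iff_aeval B hM q).1 hq

theorem MinPolyOutput.natDegree_le {x : R} {p p' : Polynomial L} (h : MinPolyOutput x p)
    (h0 : p' ≠ 0) (hx : Polynomial.aeval x p' = 0) : p.natDegree ≤ p'.natDegree := by
  have hp := h.ne_zero
  obtain ⟨d, B, M, q, hM, hq, hq0, hmin, rfl⟩ := h
  have hd := natDegree_sum_C_mul_X_pow_le q
  rcases le_or_gt p'.natDegree d with hd' | hd'
  · have hsum := sum_coeff_mul_X_pow_fin hd'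
    obtain ⟨j, hj, hj0⟩ := hmin (fun j => p'.coeff j)
      ((mulVec_eq_zero_iff_aeval B hM _).2 (by rwa [hsum]))
      (fun h => h0 (by
        rw [← hsum]
        exact Finset.sum_eq_zero fun j _ => by rw [congr_fun h j]; simp))
      ⟨_, Nat.lt_succ_of_le hd⟩ (by
        rw [← coeff_sum_C_mul_X_pow q]
        exact Polynomial.leadingCoeff_ne_zero.2 hp)
    exact (Fin.le_def.1 hj).trans (Polynomial.le_natDegree_of_ne_zero hj0)
  -- Annihilating polynomials of degree above `d` do not come from kernel vectors, but `p` has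
  -- degree at most `d` anyway.
  · exact hd.trans hd'.le

theorem exists_eq_mul_X_pow_succ_add {p : Polynomial L} (hp : p ≠ 0) :
    ∃ (b : Polynomial L) (a : L) (j : ℕ), a ≠ 0 ∧
      p = b * Polynomial.X ^ (j + 1) + Polynomial.C a * Polynomial.X ^ j := by
  obtain ⟨q, hq⟩ := Polynomial.X_pow_dvd_iff.2 fun d (hd : d < p.natTrailingDegree) =>
    Polynomial.coeff_eq_zero_of_lt_natTrailingDegree hd
  refine ⟨q.divX, q.coeff 0, p.natTrailingDegree, ?_, ?_⟩
  · have := Polynomial.coeff_X_pow_mul q p.natTrailingDegree 0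
    rw [← hq, zero_add] at this
    rw [← this]
    exact Polynomial.trailingCoeff_nonzero_iff_nonzero.2 hp
  · conv_lhs => rw [hq, ← q.divX_mul_X_add]
    ring

/-- Write `p = X ^ j * (b * X + a)` with `a ≠ 0`. For nilpotent `x` the second factor becomes a unit
at `x`, so `x ^ j = 0`, and minimality of the degree leaves only `a * X ^ j`. -/
theorem MinPolyOutput.eq_monomial_iff {x : R} {p : Polynomial L} (h : MinPolyOutput x p) :
    (∃ n c, p = Polynomial.monomial n c) ↔ IsNilpotent x := by
  constructor
  · rintro ⟨n, c, rfl⟩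
    have hc : c ≠ 0 := by
      rintro rfl
      exact h.ne_zero (Polynomial.monomial_zero_right n)
    have := h.aeval_eq_zero
    rw [Polynomial.aeval_monomial, ← Algebra.smul_def] at this
    exact ⟨n, (smul_eq_zero_iff_right hc).1 this⟩
  · intro hx
    obtain ⟨b, a, j, ha, hp⟩ := exists_eq_mul_X_pow_succ_add h.ne_zero
    have hu : IsUnit (Polynomial.aeval x b * x + algebraMap L R a) :=
      IsNilpotent.isUnit_add_right_of_commute
        (mem_nilradical.1 (Ideal.mul_mem_left _ _ (mem_nilradical.2 hx)))
        ((isUnit_iff_ne_zero.2 ha).map _) (Commute.all _ _)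
    have h0 := h.aeval_eq_zero
    have hxj : x ^ j = 0 := by
      refine hu.mul_right_eq_zero.1 ?_
      rw [← h0, hp]
      simp only [map_add, map_mul, map_pow, Polynomial.aeval_X, Polynomial.aeval_C]
      ring
    have hd := h.natDegree_le (p' := Polynomial.X ^ j) (by simp) (by simpa using hxj)
    rw [Polynomial.natDegree_X_pow] at hd
    refine ⟨j, a, ?_⟩
    ext n
    rw [Polynomial.coeff_monomial]
    split_ifs with hn
    · subst hn
      rw [hp]
      simp [Polynomial.coeff_mul_X_pow']
    · rcases lt_or_gt_of_ne hn with hn | hn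
      · exact Polynomial.coeff_eq_zero_of_natDegree_lt (hd.trans_lt hn)
      · rw [hp]
        simp [Polynomial.coeff_mul_X_pow', hn.not_ge, (hn.trans (Nat.lt_succ_self j)).not_ge]

theorem exists_minPolyOutput_monic [Module.Finite L R] (x : R) :
    ∃ p : Polynomial L, MinPolyOutput x p ∧ p.Monic := by
  classical
  let d := Module.finrank L R
  let B : Module.Basis (Fin d) L R := Module.finBasis L R
  let M : Matrix (Fin d) (Fin (d + 1)) L := fun i j => B.repr (x ^ (j : ℕ)) i
  have hM : ∀ i j, M i j = B.repr (x ^ (j : ℕ)) i := fun _ _ => rfl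
  let P : (Fin (d + 1) → L) → Polynomial L :=
    fun q => ∑ j, Polynomial.C (q j) * Polynomial.X ^ (j : ℕ)
  -- There are more columns than rows. A kernel vector whose polynomial has least degree is one
  -- whose last nonzero entry comes earliest.
  have hker : ∃ n, ∃ q, M.mulVec q = 0 ∧ q ≠ 0 ∧ (P q).natDegree = n := by
    have := LinearMap.ker_ne_bot_of_finrank_lt (f := M.mulVecLin) (by simp)
    obtain ⟨q, hq, hq0⟩ := Submodule.exists_mem_ne_zero_of_ne_bot this
    exact ⟨_, q, by simpa using hq, hq0, rfl⟩
  obtain ⟨q, hq, hq0, hdeg⟩ := Nat.find_spec hker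
  have hP0 : ∀ q, q ≠ 0 → P q ≠ 0 := by
    rintro q hq h0
    apply hq
    ext j
    rw [← coeff_sum_C_mul_X_pow q j]
    change (P q).coeff _ = _
    simp [h0]
  have hlc := Polynomial.leadingCoeff_ne_zero.2 (hP0 q hq0)
  set c := (P q).leadingCoeff
  have hPc : P (c⁻¹ • q) = Polynomial.C c⁻¹ * P q := by
    simp only [P, Finset.mul_sum, Pi.smul_apply, smul_eq_mul, map_mul, mul_assoc]
  refine ⟨P (c⁻¹ • q), ⟨d, B, M, c⁻¹ • q, hM, ?_, smul_ne_zero (inv_ne_zero hlc) hq0, ?_, rfl⟩, ?_⟩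
  · rw [Matrix.mulVec_smul, hq, smul_zero]
  · intro q' hq' hq0' j hj
    have hmin := Nat.find_min' hker ⟨q', hq', hq0', rfl⟩
    rw [← hdeg] at hmin
    refine ⟨⟨(P q').natDegree, Nat.lt_succ_of_le (natDegree_sum_C_mul_X_pow_le q')⟩, ?_, ?_⟩
    · rw [Fin.le_def]
      refine le_trans (Polynomial.le_natDegree_of_ne_zero ?_) hmin
      rw [coeff_sum_C_mul_X_pow q j]
      exact fun h => hj (by simp [h])
    · rw [← coeff_sum_C_mul_X_pow q']
      exact Polynomial.leadingCoeff_ne_zero.2 (hP0 q' hq0')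
  · rw [hPc]
    exact Polynomial.monic_C_mul_of_mul_leadingCoeff_eq_one (inv_mul_cancel₀ hlc)

end MinimalPolynomialOutput

/-! ### Monic triangular systems: finiteness, existence and zeros -/

section Monic

variable {σ : Type*} {L : Type*} [Field L]

theorem aeval_mem_of_mem_supported {A : Type*} [CommRing A] [Algebra L A] {S : Subalgebra L A}
    {y : σ → A} {s : Set σ} (hy : ∀ i ∈ s, y i ∈ S) {q : MvPolynomial σ L}
    (hq : q ∈ supported L s) : aeval y q ∈ S := by
  have : supported L s ≤ S.comap (aeval y) := by
    rw [supported_eq_adjoin_X]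
    refine Algebra.adjoin_le ?_
    rintro _ ⟨i, hi, rfl⟩
    simpa using hy i hi
  exact this hq

theorem aeval_mem_supported {s : Set σ} (h : ↥(supported L s)) (b : Polynomial L) :
    Polynomial.aeval (h : MvPolynomial σ L) b ∈ supported L s :=
  Algebra.adjoin_le (Set.singleton_subset_iff.2 h.2)
    (Polynomial.aeval_mem_adjoin_singleton _ _)

theorem aeval_eq_sum_coeffIn {A : Type*} [CommRing A] [Algebra L A] (y : σ → A) (i : σ)
    {q : MvPolynomial σ L} {d : ℕ} (hd : q.degreeOf i < d) :
    aeval y q = ∑ n ∈ Finset.range d, aeval y (coeffIn i n q) * y i ^ n := by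
  obtain ⟨e, rfl⟩ : ∃ e, d = e + 1 := ⟨d - 1, by omega⟩
  conv_lhs => rw [← truncIn_eq_self (Nat.lt_succ_iff.1 hd), truncIn]
  simp

variable [LinearOrder σ]

/-- `f` is, up to the sign of the remaining terms, monic of positive degree as a polynomial in
`T_n`, with coefficients in the polynomial ring in the later variables. -/
def IsMonicIn (n : σ) (f : MvPolynomial σ L) : Prop :=
  ∃ d, ∃ q ∈ supported L (Set.Ici n), q.degreeOf n < d ∧ f = X n ^ d - q

/-- From the last variable downwards, each generator is integral over the integral closure of `L`,
which already contains the later generators, and hence over `L`. An algebra generated by finitely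
many integral elements is finite. -/
theorem finite_of_isMonicIn [Finite σ] {A : Type*} [CommRing A] [Algebra L A] {s : Set σ}
    (hs : IsUpperSet s) (y : σ → A) (hgen : Algebra.adjoin L (y '' s) = ⊤)
    (f : σ → MvPolynomial σ L) (hf : ∀ i ∈ s, IsMonicIn i (f i)) (h0 : ∀ i ∈ s, aeval y (f i) = 0) :
    Module.Finite L A := by
  have hint : ∀ i ∈ s, IsIntegral L (y i) := by
    intro i
    induction i using WellFoundedGT.induction with
    | _ i ih =>
      intro hi
      obtain ⟨d, q, hq, hd, he⟩ := hf i hi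
      let S := integralClosure L A
      have hc : ∀ n, aeval y (coeffIn i n q) ∈ S := fun n =>
        aeval_mem_of_mem_supported (s := Set.Ici i \ {i}) (fun j hj =>
          ih j (lt_of_le_of_ne hj.1 (Ne.symm hj.2)) (hs hj.1 hi)) (coeffIn_mem_supported hq i n)
      let p : Polynomial S := ∑ n ∈ Finset.range d, Polynomial.C ⟨_, hc n⟩ * Polynomial.X ^ n
      have hp : p.degree < d := by
        refine (Polynomial.degree_sum_le _ _).trans_lt
          ((Finset.sup_lt_iff (WithBot.bot_lt_coe d)).2 fun n hn => ?_)
        exact (Polynomial.degree_C_mul_X_pow_le _ _).trans_lt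
          (WithBot.coe_lt_coe.2 (Finset.mem_range.1 hn))
      have hyi : IsIntegral S (y i) := by
        refine ⟨Polynomial.X ^ d - p, Polynomial.monic_X_pow_sub hp, ?_⟩
        have := h0 i hi
        rw [he, map_sub, map_pow, aeval_X, aeval_eq_sum_coeffIn y i hd] at this
        rw [← this]
        simp only [p, Polynomial.eval₂_sub, Polynomial.eval₂_X_pow, Polynomial.eval₂_finsetSum,
          Polynomial.eval₂_mul, Polynomial.eval₂_C]
        rfl
      exact isIntegral_trans (R := L) (y i) hyi
  have := fg_adjoin_of_finite ((Set.toFinite s).image y) (by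
    rintro _ ⟨i, hi, rfl⟩
    exact hint i hi)
  rw [hgen, Algebra.top_toSubmodule] at this
  exact ⟨this⟩

theorem finite_quotient_of_adjoin_eq_top [Finite σ] {R : Type*} [CommRing R] [Algebra L R]
    {s : Set σ} (hs : IsUpperSet s) (y : σ → R) (hgen : Algebra.adjoin L (y '' s) = ⊤)
    (f : σ → MvPolynomial σ L) (hf : ∀ i ∈ s, IsMonicIn i (f i)) (I : Ideal R)
    (h0 : ∀ i ∈ s, aeval y (f i) ∈ I) : Module.Finite L (R ⧸ I) := by
  have hmk := Ideal.Quotient.mkₐ_surjective L I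
  set mk := Ideal.Quotient.mkₐ L I with hmk'
  refine finite_of_isMonicIn hs (fun i => mk (y i)) ?_ f hf fun i hi => ?_
  · have := congr_arg (Subalgebra.map mk) hgen
    rw [AlgHom.map_adjoin, ← Set.image_comp, Algebra.map_top,
      (AlgHom.range_eq_top _).2 hmk] at this
    exact this
  · have : aeval (fun i => mk (y i)) (f i) = mk (aeval y (f i)) :=
      (comp_aeval_apply y mk (f i)).symm
    rw [this]
    exact Ideal.Quotient.eq_zero_iff_mem.2 (h0 i hi)

theorem finite_quotient_of_isMonicIn [Finite σ] (f : σ → MvPolynomial σ L)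
    (hf : ∀ i, IsMonicIn i (f i)) :
    Module.Finite L (MvPolynomial σ L ⧸ Ideal.span (Set.range f)) :=
  finite_quotient_of_adjoin_eq_top isUpperSet_univ X (by simp [adjoin_range_X]) f
    (fun i _ => hf i) _ fun i _ => by
      rw [aeval_X_left_apply]
      exact Ideal.subset_span ⟨i, rfl⟩

theorem finite_supported_quotient [Finite σ] {s : Set σ} (hs : IsUpperSet s)
    (f : σ → MvPolynomial σ L) (hf : ∀ i ∈ s, IsMonicIn i (f i)) :
    Module.Finite L (↥(supported L s) ⧸
      Ideal.span {x : ↥(supported L s) | ∃ i, i ∈ s ∧ (x : MvPolynomial σ L) = f i}) := by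
  classical
  -- The value 0 outside `s` is immaterial: only polynomials in the variables from `s` are
  -- evaluated.
  let y : σ → ↥(supported L s) := fun i => if h : i ∈ s then ⟨X i, X_mem_supported.2 h⟩ else 0
  have hy : ∀ i ∈ s, (y i : MvPolynomial σ L) = X i := fun i hi => by simp [y, hi]
  have haev : ∀ z ∈ supported L s, ((aeval y z : ↥(supported L s)) : MvPolynomial σ L) = z := by
    intro z hz
    have h1 : (supported L s).val (aeval y z) = aeval (fun i => (y i : MvPolynomial σ L)) z :=
      comp_aeval_apply _ _ _
    refine h1.trans ?_
    clear h1
    induction hz using Algebra.adjoin_induction with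
    | mem _ h => obtain ⟨i, hi, rfl⟩ := h; simp [hy i hi]
    | algebraMap c => simp
    | add u v _ _ h1 h2 => simp_all
    | mul u v _ _ h1 h2 => simp_all
  refine finite_quotient_of_adjoin_eq_top hs y (eq_top_iff.2 fun z _ => ?_) f hf _ fun i hi => ?_
  · rw [show z = aeval y (z : MvPolynomial σ L) from Subtype.ext (haev z z.2).symm]
    exact aeval_mem_of_mem_supported
      (fun i hi => Algebra.subset_adjoin (Set.mem_image_of_mem _ hi)) z.2
  · obtain ⟨d, q, hq, hd, he⟩ := hf i hi
    have hmem : f i ∈ supported L s := by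
      rw [he]
      exact sub_mem (pow_mem (X_mem_supported.2 hi) d)
        (supported_mono (fun j hj => hs hj hi) hq)
    exact Ideal.subset_span ⟨i, hi, haev _ hmem⟩

theorem finite_tailQuotient [Finite σ] (f : σ → MvPolynomial σ L) (n : σ)
    (hf : ∀ i, n < i → IsMonicIn i (f i)) : Module.Finite L (TailQuotient f n) :=
  finite_supported_quotient (isUpperSet_Ioi n) f hf

theorem MonicPass.isMonicIn {f : σ → MvPolynomial σ L} {n : σ} {fn f' : MvPolynomial σ L}
    (h : MonicPass f n fn f') : IsMonicIn n f' := by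
  obtain ⟨h, c, d, hd, -, -, hc, hcd, p, b, a, j, -, -, -, -, rfl⟩ := h
  have hmem := mul_mem (Subalgebra.algebraMap_mem (supported L (Set.Ioi n)) (-a⁻¹))
    (aeval_mem_supported h b)
  refine ⟨d, -((C (-a⁻¹) * Polynomial.aeval (h : MvPolynomial σ L) b) * c), ?_, ?_, by ring⟩
  · exact neg_mem (mul_mem (supported_mono Set.Ioi_subset_Ici_self hmem) hc)
  · rw [degreeOf_neg]
    refine (degreeOf_mul_le _ _ _).trans_lt ?_
    have := mem_supported_iff_forall_degreeOf.1 hmem n (by simp)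
    rw [algebraMap_eq] at this
    omega

theorem MinPolyOutput.congr_ideal {R : Type*} [CommRing R] [Algebra L R] {I J : Ideal R}
    (hIJ : I = J) {x : R} {p : Polynomial L} (h : MinPolyOutput (Ideal.Quotient.mk I x) p) :
    MinPolyOutput (Ideal.Quotient.mk J x) p := by
  subst hIJ
  exact h

/-- The pass at `n` reads only the polynomials with later index, so defining the value at `n` or
before does not disturb it. -/
theorem MonicPass.congr {f g : σ → MvPolynomial σ L} {n : σ} {fn f' : MvPolynomial σ L}
    (hfg : ∀ i, n < i → f i = g i) (h : MonicPass f n fn f') : MonicPass g n fn f' := by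
  have : {x : ↥(supported L (Set.Ioi n)) | ∃ i, n < i ∧ (x : MvPolynomial σ L) = f i} =
      {x : ↥(supported L (Set.Ioi n)) | ∃ i, n < i ∧ (x : MvPolynomial σ L) = g i} := by
    ext x
    exact exists_congr fun i => and_congr_right fun hi => by rw [hfg i hi]
  obtain ⟨h, c, d, h1, h2, h3, h4, h5, p, b, a, j, hp, h6⟩ := h
  exact ⟨h, c, d, h1, h2, h3, h4, h5, p, b, a, j,
    hp.congr_ideal (congr_arg Ideal.span this), h6⟩

theorem exists_monicPass [Finite σ] {f : σ → MvPolynomial σ L} {n : σ}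
    (hf : ∀ i, n < i → IsMonicIn i (f i)) {fn : MvPolynomial σ L} (hn : HasMainVar fn n) :
    ∃ f', MonicPass f n fn f' := by
  have := finite_tailQuotient f n hf
  have hpos := (hasMainVar_iff.1 hn).2
  have h0 : fn ≠ 0 := by rintro rfl; simp at hpos
  obtain ⟨p, hp, hmon⟩ := exists_minPolyOutput_monic (L := L)
    (Ideal.Quotient.mk _ ⟨_, hn.leadCoeffIn_mem⟩ : TailQuotient f n)
  obtain ⟨b, a, j, ha, he⟩ := exists_eq_mul_X_pow_succ_add hp.ne_zero
  refine ⟨_, ⟨_, hn.leadCoeffIn_mem⟩, truncIn n (fn.degreeOf n - 1) fn, fn.degreeOf n, hpos,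
    eq_leadCoeffIn_mul_add hpos, leadCoeffIn_ne_zero n h0, truncIn_mem_supported hn.1 _ _, ?_,
    p, b, a, j, hp, hmon, ha, he, rfl⟩
  have := degreeOf_truncIn_le n (fn.degreeOf n - 1) fn
  omega

/-- The output is built along upper sets by adding a new minimum. The values found so far are monic,
so the next quotient is finite-dimensional and a minimal polynomial can be computed there. -/
theorem exists_makeMonicOutput [Finite σ] {f : σ → MvPolynomial σ L}
    (hf : ∀ n, HasMainVar (f n) n) : ∃ f', MakeMonicOutput f f' := by
  classical
  have := Fintype.ofFinite σ
  suffices H : ∀ s : Finset σ, IsUpperSet (s : Set σ) → ∃ f' : σ → MvPolynomial σ L,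
      ∀ n ∈ s, MonicPass f' n (f n) (f' n) by
    obtain ⟨f', h⟩ := H Finset.univ (by simpa using isUpperSet_univ)
    exact ⟨f', fun n => h n (Finset.mem_univ n)⟩
  intro s
  induction s using Finset.induction_on_min with
  | empty => exact fun _ => ⟨f, by simp⟩
  | insert a s ha ih =>
    intro hs
    have hgt : ∀ i, a < i → i ∈ s := fun i hi => by
      have : i ∈ insert a s := hs hi.le (Finset.mem_insert_self a s)
      exact (Finset.mem_insert.1 this).resolve_left hi.ne'
    obtain ⟨f', hf'⟩ := ih fun i j hij hi => hgt j ((ha i hi).trans_le hij)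
    obtain ⟨v, hv⟩ := exists_monicPass (f := f') (fun i hi => (hf' i (hgt i hi)).isMonicIn) (hf a)
    have hne : ∀ i, a < i → f' i = Function.update f' a v i := fun i hi => by
      rw [Function.update_of_ne hi.ne']
    refine ⟨Function.update f' a v, fun n hn => ?_⟩
    rcases Finset.mem_insert.1 hn with rfl | hn
    · rw [Function.update_self]
      exact hv.congr hne
    · rw [← hne n (ha n hn)]
      exact (hf' n hn).congr fun i hi => hne i ((ha n hn).trans hi)

/-- The relation `h ^ j * (b(h) * h + a) = 0` holds modulo the later polynomials. As `φ h ≠ 0`, it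
makes `-b(h) / a` an inverse of `h` under `φ`, so that `φ h * φ f' = φ fn`. -/
theorem MonicPass.map_eq_zero_iff {f : σ → MvPolynomial σ L} {n : σ} {fn f' : MvPolynomial σ L}
    (h : MonicPass f n fn f') {Ω : Type*} [Field Ω] [Algebra L Ω] (φ : MvPolynomial σ L →ₐ[L] Ω)
    (hφ : ∀ i, n < i → φ (f i) = 0) (hlead : φ (leadCoeffIn n fn) ≠ 0) :
    φ f' = 0 ↔ φ fn = 0 := by
  obtain ⟨h, c, d, hd, rfl, h0, hc, hcd, p, b, a, j, hp, -, ha, rfl, rfl⟩ := h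
  rw [leadCoeffIn_mul_X_pow_add h0 (mem_supported_iff_forall_degreeOf.1 h.2 n (by simp)) hcd]
    at hlead
  -- The minimal polynomial annihilates only the class of `h`, so `φ` has to descend to the
  -- quotient.
  let ψ : TailQuotient f n →ₐ[L] Ω := Ideal.Quotient.liftₐ _ (φ.comp (Subalgebra.val _)) (by
    intro z hz
    rw [← RingHom.mem_ker]
    refine Ideal.span_le.2 ?_ hz
    rintro x ⟨i, hi, hx⟩
    simp [hx, hφ i hi])
  have hψ : ψ (Ideal.Quotient.mk _ h) = φ h := rfl
  have hz := congr_arg ψ hp.aeval_eq_zero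
  rw [map_zero, ← Polynomial.aeval_algHom_apply, hψ] at hz
  simp only [map_add, map_mul, map_pow, Polynomial.aeval_X, Polynomial.aeval_C] at hz
  have hz' : Polynomial.aeval (φ h) b * φ h + algebraMap L Ω a = 0 := by
    refine (mul_eq_zero.1 (?_ : φ h ^ j * _ = 0)).resolve_left (pow_ne_zero j hlead)
    rw [← hz]; ring
  have ha' : algebraMap L Ω a ≠ 0 := (map_ne_zero _).2 ha
  have key : φ h * φ (X n ^ d + (C (-a⁻¹) * Polynomial.aeval (h : MvPolynomial σ L) b) * c) =
      φ ((h : MvPolynomial σ L) * X n ^ d + c) := by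
    have hC : φ (C (-a⁻¹)) = -(algebraMap L Ω a)⁻¹ := by
      rw [← algebraMap_eq, AlgHom.commutes, map_neg, map_inv₀]
    simp only [map_add, map_mul, map_pow, hC, ← Polynomial.aeval_algHom_apply]
    have : Polynomial.aeval (φ h) b * φ h = -algebraMap L Ω a := eq_neg_of_add_eq_zero_left hz'
    field_simp
    linear_combination (-φ c) * this
  rw [← key, mul_eq_zero, or_iff_right hlead]

end Monic

/-! ### Lifting a solution to a generic one through a valuation ring -/

section Lifting

open IsLocalRing (residue ResidueField)

/-- Over `Ω`, `P(a)` is the leading coefficient, of valuation 1, times the product of the `a - α`.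
Since `P(a)` has valuation below 1, so has some factor, and that root `α` lies in `B` with the
residue of `a`. No henselian property is needed because `Ω` is algebraically closed. -/
theorem exists_root_residue_eq {Ω : Type*} [Field Ω] [IsAlgClosed Ω] (B : ValuationSubring Ω)
    {P : Polynomial B} {ξ : ResidueField B} (h0 : residue B P.leadingCoeff ≠ 0)
    (hξ : (P.map (residue B)).eval ξ = 0) : ∃ t : B, P.eval t = 0 ∧ residue B t = ξ := by
  obtain ⟨a, rfl⟩ := IsLocalRing.residue_surjective ξ
  rw [Polynomial.eval_map_apply, IsLocalRing.residue_eq_zero_iff, B.valuation_lt_one_iff] at hξ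
  have hinj : Function.Injective B.subtype := Subtype.val_injective
  have hlc : B.valuation (P.leadingCoeff : Ω) = 1 := by
    rw [← B.valuation_eq_one_iff]
    by_contra h
    exact h0 ((IsLocalRing.residue_eq_zero_iff _).2 h)
  have hev := (IsAlgClosed.splits (P.map B.subtype)).eval_eq_prod_roots (a : Ω)
  have hval : (P.map B.subtype).eval (a : Ω) = ((P.eval a : B) : Ω) :=
    Polynomial.eval_map_apply B.subtype a
  rw [hval, Polynomial.leadingCoeff_map_of_injective hinj] at hev
  rw [hev, map_mul] at hξ
  have hξ' : B.valuation ((P.map B.subtype).roots.map fun α => (a : Ω) - α).prod < 1 := by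
    have h : B.valuation (B.subtype P.leadingCoeff) = 1 := hlc
    rwa [h, one_mul] at hξ
  rw [map_multiset_prod, Multiset.map_map] at hξ'
  obtain ⟨α, hα, hlt⟩ : ∃ α ∈ (P.map B.subtype).roots, B.valuation ((a : Ω) - α) < 1 := by
    by_contra! hc
    refine hξ'.not_ge (Multiset.one_le_prod fun v hv => ?_)
    obtain ⟨α, hα, rfl⟩ := Multiset.mem_map.1 hv
    exact hc α hα
  have hmem : (a : Ω) - α ∈ B := (B.valuation_le_one_iff _).1 hlt.le
  have hαB : α ∈ B := by
    have := sub_mem a.2 hmem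
    rwa [sub_sub_cancel] at this
  refine ⟨⟨α, hαB⟩, ?_, ?_⟩
  · apply hinj
    rw [map_zero, ← Polynomial.eval_map_apply]
    exact (Polynomial.mem_roots'.1 hα).2
  · have : residue B ⟨_, hmem⟩ = 0 :=
      (IsLocalRing.residue_eq_zero_iff _).2 ((B.valuation_lt_one_iff _).2 hlt)
    have h2 : (⟨_, hmem⟩ : B) = a - ⟨α, hαB⟩ := rfl
    rw [h2, map_sub, sub_eq_zero] at this
    exact this.symm

variable {r : ℕ} {K : Type*} [Field K]

theorem eval₂_congr_of_mem_supported {σ R S : Type*} [CommSemiring R] [CommSemiring S] {k : R →+* S}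
    {y z : σ → S} {s : Set σ} {f : MvPolynomial σ R} (hf : f ∈ supported R s)
    (h : ∀ i ∈ s, y i = z i) : eval₂ k y f = eval₂ k z f :=
  eval₂Hom_congr' rfl (fun i hi _ => h i (mem_supported.1 hf hi)) rfl

theorem eval₂_eq_sum_coeffIn {σ R S : Type*} [CommSemiring R] [CommSemiring S] (k : R →+* S)
    (y : σ → S) (i : σ) (f : MvPolynomial σ R) :
    eval₂ k y f = ∑ n ∈ Finset.range (f.degreeOf i + 1), eval₂ k y (coeffIn i n f) * y i ^ n := by
  conv_lhs => rw [← truncIn_eq_self (le_refl (f.degreeOf i)), truncIn]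
  simp [eval₂_sum]

/-- The coordinates are corrected from the last to the first. The coefficients of the polynomial
with main variable `a` involve only later, already corrected coordinates, and polynomials treated
earlier do not involve `T_a`. -/
theorem exists_lift_zero {Ω : Type*} [Field Ω] [IsAlgClosed Ω] (B : ValuationSubring Ω)
    (k : K →+* B) (y : Fin r → B) {F : Finset (MvPolynomial (Fin r) K)} (hF : TriangularShape F)
    (h0 : ∀ f ∈ F, eval₂ ((residue B).comp k) (fun i => residue B (y i)) f = 0)
    (hlead : ∀ f ∈ F, ∀ i, HasMainVar f i →
      eval₂ ((residue B).comp k) (fun i => residue B (y i)) (leadCoeffIn i f) ≠ 0) :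
    ∃ z : Fin r → B, (∀ i, residue B (z i) = residue B (y i)) ∧
      (∀ i, (∀ f ∈ F, ¬ HasMainVar f i) → z i = y i) ∧ ∀ f ∈ F, eval₂ k z f = 0 := by
  classical
  suffices H : ∀ s : Finset (Fin r), ∃ z : Fin r → B, (∀ i, residue B (z i) = residue B (y i)) ∧
      (∀ i, (∀ f ∈ F, ¬ HasMainVar f i) → z i = y i) ∧
      ∀ f ∈ F, ∀ i ∈ s, HasMainVar f i → eval₂ k z f = 0 by
    obtain ⟨z, h1, h2, h3⟩ := H Finset.univ
    refine ⟨z, h1, h2, fun f hf => ?_⟩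
    obtain ⟨i, hi⟩ := hF.1 f hf
    exact h3 f hf i (Finset.mem_univ i) hi
  intro s
  induction s using Finset.induction_on_min with
  | empty => exact ⟨y, fun _ => rfl, fun _ _ => rfl, by simp⟩
  | insert a s ha ih =>
    obtain ⟨z, hz1, hz2, hz3⟩ := ih
    by_cases hex : ∃ f ∈ F, HasMainVar f a
    swap
    · push Not at hex
      refine ⟨z, hz1, hz2, fun f hf i hi hfi => ?_⟩
      rcases Finset.mem_insert.1 hi with rfl | hi
      · exact absurd hfi (hex f hf)
      · exact hz3 f hf i hi hfi
    obtain ⟨f, hf, hfa⟩ := hex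
    let P : Polynomial B := ∑ n ∈ Finset.range (f.degreeOf a + 1),
      Polynomial.C (eval₂ k z (coeffIn a n f)) * Polynomial.X ^ n
    have hzy : ∀ q, residue B (eval₂ k z q) =
        eval₂ ((residue B).comp k) (fun i => residue B (y i)) q := by
      intro q
      rw [eval₂_comp_left]
      exact congr_arg (fun w => eval₂ _ w q) (funext hz1)
    have hPcoeff : P.coeff (f.degreeOf a) = eval₂ k z (leadCoeffIn a f) := by
      simp only [P, Polynomial.finsetSum_coeff, Polynomial.coeff_C_mul_X_pow]
      simp [leadCoeffIn]
    have hPne : residue B (P.coeff (f.degreeOf a)) ≠ 0 := by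
      rw [hPcoeff, hzy]
      exact hlead f hf a hfa
    -- The coefficient in this degree is nonzero even in the residue field, so the degree does not
    -- drop.
    have hPdeg : P.natDegree = f.degreeOf a := by
      refine le_antisymm (Polynomial.natDegree_sum_le_of_forall_le _ _ fun n hn =>
        (Polynomial.natDegree_C_mul_X_pow_le _ _).trans
          (Nat.lt_succ_iff.1 (Finset.mem_range.1 hn))) ?_
      refine Polynomial.le_natDegree_of_ne_zero fun h => hPne ?_
      rw [h, map_zero]
    obtain ⟨t, ht, hta⟩ := exists_root_residue_eq B (P := P) (ξ := residue B (y a))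
      (by rwa [Polynomial.leadingCoeff, hPdeg]) (by
        rw [← h0 f hf, eval₂_eq_sum_coeffIn _ _ a f]
        simp [P, Polynomial.map_sum, Polynomial.eval_finsetSum, hzy])
    have hne : ∀ i, i ≠ a → Function.update z a t i = z i := fun i hi =>
      Function.update_of_ne hi _ _
    refine ⟨Function.update z a t, fun i => ?_, fun i hi => ?_, fun g hg i hi hgi => ?_⟩
    · by_cases hia : i = a
      · subst hia
        rw [Function.update_self, hta]
      · rw [hne i hia, hz1]
    · rw [hne i (by rintro rfl; exact hi f hf hfa), hz2 i hi]
    · rcases Finset.mem_insert.1 hi with rfl | hi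
      · obtain rfl := hF.2 g hg f hf i hgi hfa
        rw [eval₂_eq_sum_coeffIn _ _ i g, ← ht]
        simp only [P, Polynomial.eval_finsetSum, Polynomial.eval_mul, Polynomial.eval_C,
          Polynomial.eval_pow, Polynomial.eval_X, Function.update_self]
        refine Finset.sum_congr rfl fun n _ => ?_
        rw [eval₂_congr_of_mem_supported (coeffIn_mem_supported hgi.1 i n)
          (fun j hj => hne j hj.2)]
      · rw [← hz3 g hg i hi hgi]
        exact eval₂_congr_of_mem_supported hgi.1 fun j hj =>
          hne j ((ha i hi).trans_le hj).ne'

/-- Inside `Ω`, the algebraic closure of Frac E[X_1, …, X_r], a valuation ring containing E[X_1, …,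
X_r] is chosen in which every polynomial vanishing at `x` is a nonunit, so that each `X_i` reduces
to `x_i`. The free coordinates stay equal to `X_i`, the others are lifted, and g survives because
its residue is the image of `g(x)`. -/
theorem exists_generic_zero {E : Type*} [Field E] [Algebra K E] (x : Fin r → E)
    {F : Finset (MvPolynomial (Fin r) K)} (hF : TriangularShape F)
    (h0 : ∀ f ∈ F, aeval x f = 0) {g : MvPolynomial (Fin r) K} (hg : aeval x g ≠ 0)
    (hlead : ∀ f ∈ F, ∀ i, HasMainVar f i → leadCoeffIn i f ∣ g) :
    ∃ (k : K →+* AlgebraicClosure (FractionRing (MvPolynomial (Fin r) E)))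
      (y : Fin r → AlgebraicClosure (FractionRing (MvPolynomial (Fin r) E))),
      Function.Injective (eval₂Hom k fun i : ↥({i | ∃ f ∈ F, HasMainVar f i}ᶜ) => y i) ∧
      (∀ f ∈ F, eval₂ k y f = 0) ∧ eval₂ k y g ≠ 0 := by
  let Q := FractionRing (MvPolynomial (Fin r) E)
  let ι : MvPolynomial (Fin r) E →+* AlgebraicClosure Q :=
    (algebraMap Q (AlgebraicClosure Q)).comp (algebraMap (MvPolynomial (Fin r) E) Q)
  have hι : Function.Injective ι :=
    (algebraMap Q (AlgebraicClosure Q)).injective.comp (IsFractionRing.injective _ _)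
  -- The valuation ring is obtained from a subring of `Ω` with a proper ideal, so the polynomial
  -- ring is identified with its image.
  let e' : MvPolynomial (Fin r) E ≃+* ι.range := RingEquiv.ofBijective ι.rangeRestrict
    ⟨fun a b h => hι (congr_arg Subtype.val h), ι.rangeRestrict_surjective⟩
  let e : ι.range →+* MvPolynomial (Fin r) E := e'.symm
  have he : ∀ c, e (ι.rangeRestrict c) = c := fun c => e'.symm_apply_apply c
  obtain ⟨B, hB1, hB2⟩ := Ideal.image_subset_nonunits_valuationSubring
    ((RingHom.ker (eval x)).comap e) (Ideal.comap_ne_top _ (RingHom.ker_ne_top _))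
  let ιB : MvPolynomial (Fin r) E →+* B := ι.codRestrict B.toSubring fun c => hB1 ⟨c, rfl⟩
  have hker : ∀ c, eval x c = 0 → residue B (ιB c) = 0 := by
    intro c hc
    rw [IsLocalRing.residue_eq_zero_iff, ← ValuationSubring.coe_mem_nonunits_iff]
    refine hB2 ⟨ι.rangeRestrict c, ?_, rfl⟩
    change e (ι.rangeRestrict c) ∈ RingHom.ker (eval x)
    rw [he]
    exact hc
  let ε : E →+* ResidueField B := (residue B).comp (ιB.comp C)
  -- Reduction is evaluation at `x` followed by the embedding `ε`, as `c` minus its value vanishes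
  -- at `x`.
  have hε : ∀ c, residue B (ιB c) = ε (eval x c) := by
    intro c
    have := hker (c - C (eval x c)) (by simp)
    rwa [map_sub, map_sub, sub_eq_zero] at this
  let k : K →+* B := (ιB.comp C).comp (algebraMap K E)
  have hev : ∀ q, eval₂ ((residue B).comp k) (fun i => residue B (ιB (X i))) q = ε (aeval x q) := by
    intro q
    rw [aeval_def, eval₂_comp_left]
    have : (fun i => residue B (ιB (X i))) = ε ∘ x := by
      funext i
      rw [hε, eval_X]
      rfl
    rw [this]
    rfl
  have hlead0 : ∀ f ∈ F, ∀ i, HasMainVar f i → aeval x (leadCoeffIn i f) ≠ 0 := by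
    intro f hf i hi h
    obtain ⟨q, rfl⟩ := hlead f hf i hi
    exact hg (by rw [map_mul, h, zero_mul])
  obtain ⟨z, hz1, hz2, hz3⟩ := exists_lift_zero B k (fun i => ιB (X i)) hF
    (fun f hf => by rw [hev, h0 f hf, map_zero])
    (fun f hf i hi => by rw [hev]; exact (map_ne_zero ε).2 (hlead0 f hf i hi))
  have hsub : ∀ q, eval₂ (B.subtype.comp k) (fun i => B.subtype (z i)) q =
      B.subtype (eval₂ k z q) := fun q => (eval₂_comp_left B.subtype k z q).symm
  refine ⟨B.subtype.comp k, fun i => B.subtype (z i), ?_, fun f hf => ?_, ?_⟩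
  · have : eval₂Hom (B.subtype.comp k)
        (fun i : ↥({i | ∃ f ∈ F, HasMainVar f i}ᶜ) => B.subtype (z i)) =
        (ι.comp (map (algebraMap K E))).comp (rename Subtype.val).toRingHom := by
      refine ringHom_ext (fun c => ?_) (fun i => ?_)
      · rw [eval₂Hom_C]
        change ι (C (algebraMap K E c)) = ι (map (algebraMap K E) (rename Subtype.val (C c)))
        rw [rename_C, map_C]
      · rw [eval₂Hom_X', hz2 i fun f hf hi => i.2 ⟨f, hf, hi⟩]
        change ι (X i) = ι (map (algebraMap K E) (rename Subtype.val (X i)))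
        rw [rename_X, map_X]
    rw [this]
    exact (hι.comp (map_injective _ (algebraMap K E).injective)).comp
      (rename_injective _ Subtype.val_injective)
  · rw [hsub, hz3 f hf, map_zero]
  · rw [hsub]
    intro h
    have h' : eval₂ k z g = 0 := Subtype.val_injective h
    have := congr_arg (residue B) h'
    rw [eval₂_comp_left, map_zero] at this
    have hz : (residue B) ∘ z = fun i => residue B (ιB (X i)) := funext hz1
    rw [hz, hev] at this
    exact (map_ne_zero ε).2 hg this

end Lifting

/-! ### Passage to the function field of the free variables -/

section FieldSwap

variable {r : ℕ} {K : Type*} [Field K]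

theorem exists_eval₂_fieldSwap {Ω : Type*} [Field Ω] (J : Set (Fin r)) (k : K →+* Ω)
    (y : Fin r → Ω) (hy : Function.Injective (eval₂Hom k fun i : ↥(Jᶜ) => y i)) :
    ∃ l : FunctionField K J →+* Ω, ∀ q,
      eval₂ l (fun j : J => y j) (fieldSwap J q) = eval₂ k y q := by
  refine ⟨IsFractionRing.lift hy, fun q => ?_⟩
  have : (eval₂Hom (IsFractionRing.lift hy) fun j : J => y j).comp
      (fieldSwap (K := K) J).toRingHom = eval₂Hom k y := by
    refine ringHom_ext (fun c => ?_) (fun i => ?_)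
    · rw [eval₂Hom_C, RingHom.comp_apply]
      have h1 : (fieldSwap (K := K) J).toRingHom (C c) =
          C (algebraMap (MvPolynomial (↥(Jᶜ)) K) (FunctionField K J) (C c)) := by
        change fieldSwap J (C c) = _
        rw [← algebraMap_eq, AlgHom.commutes]
        rfl
      rw [h1, eval₂Hom_C, IsFractionRing.lift_algebraMap, eval₂Hom_C]
    · rw [eval₂Hom_X', RingHom.comp_apply]
      change eval₂Hom _ _ (fieldSwap J (X i)) = _
      rw [fieldSwap, aeval_X]
      split_ifs with h
      · rw [eval₂Hom_X']
      · rw [eval₂Hom_C, IsFractionRing.lift_algebraMap, eval₂Hom_X']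
  exact congr_arg (fun φ : _ →+* Ω => φ q) this

/-- The preceding lemma applies to the tautological point of the fraction field of the whole
polynomial ring, so evaluation recovers `q` from its image. -/
theorem fieldSwap_injective (J : Set (Fin r)) :
    Function.Injective (fieldSwap J : MvPolynomial (Fin r) K →ₐ[K] _) := by
  let ι := algebraMap (MvPolynomial (Fin r) K) (FractionRing (MvPolynomial (Fin r) K))
  have hι : Function.Injective ι := IsFractionRing.injective _ _
  -- Used twice: with the inclusion of the complement of `J`, for algebraic independence, and with
  -- `id`, to identify evaluation with `ι`.
  have h1 : ∀ (τ : Type) (v : τ → Fin r), eval₂Hom (ι.comp C) (fun i => ι (X (v i))) =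
      ι.comp (rename v : MvPolynomial τ K →ₐ[K] _).toRingHom := by
    intro τ v
    refine ringHom_ext (fun c => ?_) (fun i => ?_)
    · rw [eval₂Hom_C]
      change _ = ι (rename v (C c))
      rw [rename_C]
      rfl
    · rw [eval₂Hom_X']
      change _ = ι (rename v (X i))
      rw [rename_X]
  obtain ⟨l, hl⟩ := exists_eval₂_fieldSwap J (ι.comp C) (fun i => ι (X i)) (by
    rw [h1 _ Subtype.val]
    exact hι.comp (rename_injective _ Subtype.val_injective))
  intro p q hpq
  apply hι
  have h2 : ∀ q, eval₂ (ι.comp C) (fun i => ι (X i)) q = ι q := by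
    intro q
    have := congr_arg (fun φ : _ →+* FractionRing (MvPolynomial (Fin r) K) => φ q) (h1 _ id)
    refine this.trans ?_
    change ι (rename id q) = _
    rw [rename_id_apply]
  rw [← h2, ← h2, ← hl, ← hl, hpq]

theorem fieldSwap_mem_supported (J : Set (Fin r)) {s : Set (Fin r)} {q : MvPolynomial (Fin r) K}
    (hq : q ∈ supported K s) :
    fieldSwap J q ∈ supported (FunctionField K J) {j : J | (j : Fin r) ∈ s} := by
  induction hq using Algebra.adjoin_induction with
  | mem _ h =>
    obtain ⟨i, hi, rfl⟩ := h
    rw [fieldSwap, aeval_X]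
    split_ifs with h
    · exact X_mem_supported.2 hi
    · exact Subalgebra.algebraMap_mem _ _
  | algebraMap c =>
    rw [AlgHom.commutes, IsScalarTower.algebraMap_apply K (FunctionField K J)]
    exact Subalgebra.algebraMap_mem _ _
  | add u v _ _ h1 h2 => rw [map_add]; exact add_mem h1 h2
  | mul u v _ _ h1 h2 => rw [map_mul]; exact mul_mem h1 h2

theorem fieldSwap_X {J : Set (Fin r)} (j : J) :
    fieldSwap J (X (j : Fin r) : MvPolynomial (Fin r) K) = X j := by
  rw [fieldSwap, aeval_X, dif_pos j.2]

theorem degreeOf_fieldSwap_le {J : Set (Fin r)} (j : J) (q : MvPolynomial (Fin r) K) :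
    (fieldSwap J q).degreeOf j ≤ q.degreeOf (j : Fin r) := by
  conv_lhs => rw [← truncIn_eq_self (le_refl (q.degreeOf (j : Fin r))), truncIn, map_sum]
  refine (degreeOf_sum_le _ _ _).trans (Finset.sup_le fun n hn => ?_)
  have h1 : (fieldSwap J (coeffIn (j : Fin r) n q)).degreeOf j = 0 := by
    have hc : coeffIn (j : Fin r) n q ∈ supported K {(j : Fin r)}ᶜ := by
      rw [mem_supported_iff_forall_degreeOf]
      intro i hi
      obtain rfl : i = j := by simpa using hi
      exact degreeOf_coeffIn_self _ _ _
    exact mem_supported_iff_forall_degreeOf.1 (fieldSwap_mem_supported J hc) j (by simp)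
  rw [map_mul, map_pow, fieldSwap_X]
  refine (degreeOf_mul_le _ _ _).trans ?_
  rw [h1, degreeOf_X_self_pow, zero_add]
  exact Nat.lt_succ_iff.1 (Finset.mem_range.1 hn)

/-- By injectivity the leading coefficient stays nonzero, so the degree in the main variable cannot
drop. -/
theorem HasMainVar.fieldSwap {J : Set (Fin r)} {j : J} {q : MvPolynomial (Fin r) K}
    (hq : HasMainVar q (j : Fin r)) : HasMainVar (fieldSwap J q) j ∧
      leadCoeffIn j (MonomialContainment.fieldSwap J q) =
        MonomialContainment.fieldSwap J (leadCoeffIn (j : Fin r) q) := by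
  have hpos := (hasMainVar_iff.1 hq).2
  have hne : q ≠ 0 := by rintro rfl; simp at hpos
  have heq := congr_arg (MonomialContainment.fieldSwap J) (eq_leadCoeffIn_mul_add hpos)
  rw [map_add, map_mul, map_pow, fieldSwap_X] at heq
  have h0 : MonomialContainment.fieldSwap J (leadCoeffIn (j : Fin r) q) ≠ 0 := by
    rw [Ne, map_eq_zero_iff _ (fieldSwap_injective J)]
    exact leadCoeffIn_ne_zero _ hne
  have h1 : (MonomialContainment.fieldSwap J (leadCoeffIn (j : Fin r) q)).degreeOf j = 0 :=
    mem_supported_iff_forall_degreeOf.1 (fieldSwap_mem_supported J hq.leadCoeffIn_mem) j (by simp)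
  have h2 : (MonomialContainment.fieldSwap J
      (truncIn (j : Fin r) (q.degreeOf (j : Fin r) - 1) q)).degreeOf j <
        q.degreeOf (j : Fin r) := by
    have h3 := degreeOf_fieldSwap_le j (truncIn (j : Fin r) (q.degreeOf (j : Fin r) - 1) q)
    have h4 := degreeOf_truncIn_le (j : Fin r) (q.degreeOf (j : Fin r) - 1) q
    omega
  refine ⟨hasMainVar_iff.2 ⟨?_, ?_⟩, ?_⟩
  · exact fieldSwap_mem_supported J hq.1
  · rw [heq, degreeOf_mul_X_pow_add h0 h1 h2]
    exact hpos
  · rw [heq, leadCoeffIn_mul_X_pow_add h0 h1 h2]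

end FieldSwap

/-! ### Correctness of the solvability test -/

section SolvabilityTest

variable {r : ℕ} {K : Type*} [Field K]

/-- The points with coordinates in `E` at which the members of `F_□` and `F_◁` vanish and `g` does
not. -/
def System.solutions (E : Type*) [Field E] [Algebra K E] (S : System r K) : Set (Fin r → E) :=
  {x | (∀ f ∈ S.unsorted, aeval x f = 0) ∧ (∀ f ∈ S.sorted, aeval x f = 0) ∧ aeval x S.ineq ≠ 0}

theorem exists_testPolynomial (S : System r K) :
    ∃ p, TestPolynomial S p := by
  choose q hq hmain using fun i : ↥S.mainVars => i.2
  obtain ⟨f', hf'⟩ := exists_makeMonicOutput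
    (f := fun i => fieldSwap S.mainVars (q i)) fun i => (hmain i).fieldSwap.1
  have := finite_quotient_of_isMonicIn f' fun i => (hf' i).isMonicIn
  obtain ⟨p, hp, -⟩ := exists_minPolyOutput_monic (L := FunctionField K S.mainVars)
    (Ideal.Quotient.mk (Ideal.span (Set.range f')) (fieldSwap S.mainVars S.ineq))
  exact ⟨p, _, f', fun i => ⟨q i, hq i, hmain i, rfl⟩, hf', hp⟩

/-- Each pass compares zeros only where the later new polynomials vanish. This is given in one
direction, and supplied by induction from the last variable in the other. -/
theorem MakeMonicOutput.forall_map_eq_zero_iff {σ : Type*} [LinearOrder σ] [Finite σ] {L : Type*}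
    [Field L] {f f' : σ → MvPolynomial σ L} (h : MakeMonicOutput f f') {Ω : Type*} [Field Ω]
    [Algebra L Ω] (φ : MvPolynomial σ L →ₐ[L] Ω) (hlead : ∀ i, φ (leadCoeffIn i (f i)) ≠ 0) :
    (∀ i, φ (f' i) = 0) ↔ ∀ i, φ (f i) = 0 := by
  constructor
  · exact fun h0 i => ((h i).map_eq_zero_iff φ (fun j _ => h0 j) (hlead i)).1 (h0 i)
  · intro h0 i
    induction i using WellFoundedGT.induction with
    | _ i ih => exact ((h i).map_eq_zero_iff φ ih (hlead i)).2 (h0 i)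

theorem map_leadCoeffIn_ne_zero {S : System r K} (hS : S.IsSemiTriangular) {Ω : Type*} [Field Ω]
    [Algebra (FunctionField K S.mainVars) Ω]
    (φ : MvPolynomial (↥S.mainVars) (FunctionField K S.mainVars) →ₐ[FunctionField K S.mainVars] Ω)
    (hg : φ (fieldSwap S.mainVars S.ineq) ≠ 0) (i : ↥S.mainVars) {q : MvPolynomial (Fin r) K}
    (hq : q ∈ S.sorted) (hi : HasMainVar q i) :
    φ (leadCoeffIn i (fieldSwap S.mainVars q)) ≠ 0 := by
  rw [hi.fieldSwap.2]
  intro h0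
  obtain ⟨a, ha⟩ := hS.lead_dvd q hq i hi
  exact hg (by rw [ha, map_mul, map_mul, h0, zero_mul])

theorem exists_algHom_fractionRing_ker (L : Type*) {A : Type*} [Field L] [CommRing A] [Algebra L A]
    (P : Ideal A) [P.IsPrime] :
    ∃ φ : A →ₐ[L] FractionRing (A ⧸ P), ∀ q, φ q = 0 ↔ q ∈ P := by
  refine ⟨(IsScalarTower.toAlgHom L (A ⧸ P) (FractionRing (A ⧸ P))).comp (Ideal.Quotient.mkₐ _ P),
    fun q => ?_⟩
  change algebraMap (A ⧸ P) (FractionRing (A ⧸ P)) (Ideal.Quotient.mk P q) = 0 ↔ _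
  rw [map_eq_zero_iff _ (IsFractionRing.injective (A ⧸ P) (FractionRing (A ⧸ P))),
    Ideal.Quotient.eq_zero_iff_mem]

theorem TestPolynomial.eq_monomial_iff {S : System r K} (hS : S.IsTriangular)
    (hno : ∀ c : K, c ≠ 0 → C c ∉ S.unsorted)
    {p : Polynomial (FunctionField K S.mainVars)} (hp : TestPolynomial S p) :
    (∃ n c, p = Polynomial.monomial n c) ↔ S.solutions (AlgebraicClosure K) = ∅ := by
  obtain ⟨f, f', hf, hf', hp⟩ := hp
  rw [hp.eq_monomial_iff]
  have hfS : ∀ q ∈ S.sorted, ∃ i, f i = fieldSwap S.mainVars q := by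
    intro q hq
    obtain ⟨i, hi⟩ := hS.1.shape.1 q hq
    obtain ⟨q', hq', hi', he⟩ := hf ⟨i, q, hq, hi⟩
    exact ⟨_, he.trans (by rw [hS.1.shape.2 q' hq' q hq i hi' hi])⟩
  constructor
  · rintro ⟨n, hn⟩
    rw [Set.eq_empty_iff_forall_notMem]
    rintro x ⟨-, hx, hxg⟩
    -- The point `x` itself need not extend to the function field; a generic zero does, and it gives
    -- a map out of R under which g is nonzero.
    obtain ⟨k, y, hinj, hy, hyg⟩ := exists_generic_zero x hS.1.shape hx hxg hS.1.lead_dvd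
    obtain ⟨l, hl⟩ := exists_eval₂_fieldSwap S.mainVars k y hinj
    let := l.toAlgebra
    let φ : MvPolynomial (↥S.mainVars) (FunctionField K S.mainVars)
      →ₐ[FunctionField K S.mainVars] _ := aeval fun j : ↥S.mainVars => y j
    have hφ : ∀ q, φ (fieldSwap S.mainVars q) = eval₂ k y q := hl
    have hg : φ (fieldSwap S.mainVars S.ineq) ≠ 0 := by rwa [hφ]
    have hzero := (hf'.forall_map_eq_zero_iff φ fun i => by
      obtain ⟨q, hq, hi, he⟩ := hf i
      rw [he]
      exact map_leadCoeffIn_ne_zero hS.1 φ hg i hq hi).2 fun i => by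
        obtain ⟨q, hq, hi, he⟩ := hf i
        rw [he, hφ, hy q hq]
    have hle : Ideal.span (Set.range f') ≤ RingHom.ker φ := by
      rw [Ideal.span_le]
      rintro _ ⟨i, rfl⟩
      exact hzero i
    rw [← map_pow, Ideal.Quotient.eq_zero_iff_mem] at hn
    have := hle hn
    rw [RingHom.mem_ker, map_pow] at this
    exact hg (eq_zero_of_pow_eq_zero this)
  · intro hemp
    by_contra hnil
    have hrad : fieldSwap S.mainVars S.ineq ∉ (Ideal.span (Set.range f')).radical := by
      rintro ⟨n, hn⟩
      exact hnil ⟨n, by rwa [← map_pow, Ideal.Quotient.eq_zero_iff_mem]⟩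
    rw [Ideal.radical_eq_sInf, Ideal.mem_sInf] at hrad
    push Not at hrad
    obtain ⟨P, ⟨hP, hprime⟩, hgP⟩ := hrad
    have : P.IsPrime := hprime
    obtain ⟨φ, hφ⟩ := exists_algHom_fractionRing_ker (FunctionField K S.mainVars) P
    have hg : φ (fieldSwap S.mainVars S.ineq) ≠ 0 := by rwa [Ne, hφ]
    have hzero := (hf'.forall_map_eq_zero_iff φ fun i => by
      obtain ⟨q, hq, hi, he⟩ := hf i
      rw [he]
      exact map_leadCoeffIn_ne_zero hS.1 φ hg i hq hi).1 fun i =>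
        (hφ _).2 (hP (Ideal.subset_span ⟨i, rfl⟩))
    have hprime' : (P.comap (fieldSwap S.mainVars)).IsPrime := Ideal.IsPrime.comap _
    have hnot : S.ineq ∉ P.comap (fieldSwap S.mainVars) := hgP
    -- Nullstellensatz: a polynomial outside the prime is nonzero at some point of its zero locus.
    rw [← IsPrime.vanishingIdeal_zeroLocus (K := AlgebraicClosure K)
      (P.comap (fieldSwap S.mainVars)), mem_vanishingIdeal_iff] at hnot
    push Not at hnot
    obtain ⟨x, hx, hxg⟩ := hnot
    refine Set.eq_empty_iff_forall_notMem.1 hemp x ⟨fun q hq => ?_, fun q hq => ?_, hxg⟩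
    · obtain ⟨c, rfl⟩ := hS.2 q hq
      have : c = 0 := by
        by_contra hc
        exact hno c hc hq
      simp [this]
    · obtain ⟨i, hi⟩ := hfS q hq
      refine hx q ?_
      rw [Ideal.mem_comap, ← hi, ← hφ]
      exact hzero i

theorem exists_isSolvable {S : System r K} (hS : S.IsTriangular) : ∃ b, IsSolvable S b := by
  by_cases hno : ∀ c : K, c ≠ 0 → C c ∉ S.unsorted
  · obtain ⟨p, hp⟩ := exists_testPolynomial S
    by_cases hmon : ∃ n c, p = Polynomial.monomial n c
    · exact ⟨_, .isMonomial hS hno p hp hmon⟩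
    · exact ⟨_, .notMonomial hS hno p hp hmon⟩
  · push Not at hno
    obtain ⟨c, hc, hmem⟩ := hno
    exact ⟨_, .unit hS c hc hmem⟩

theorem IsSolvable.eq_true_iff {S : System r K} {b : Bool} (h : IsSolvable S b) :
    b = true ↔ (S.solutions (AlgebraicClosure K)).Nonempty := by
  cases h with
  | unit hS c hc hmem =>
    refine ⟨by simp, fun ⟨x, hx, _⟩ => absurd (hx _ hmem) ?_⟩
    rw [algHom_C]
    exact (map_ne_zero _).2 hc
  | isMonomial hS hno p hp hmon =>
    rw [(hp.eq_monomial_iff hS hno).1 hmon]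
    simp
  | notMonomial hS hno p hp hmon =>
    rw [hp.eq_monomial_iff hS hno] at hmon
    simpa [Set.nonempty_iff_ne_empty] using hmon

end SolvabilityTest

/-! ### Solution sets under reduction and expansion -/

section Solutions

variable {r : ℕ} {K : Type*} [Field K] {E : Type*} [Field E] [Algebra K E]

theorem ReduceStep.forall_aeval_eq_zero_iff {F G : Finset (MvPolynomial (Fin r) K)}
    (h : ReduceStep F G) (x : Fin r → E) :
    (∀ f ∈ G, aeval x f = 0) ↔ ∀ f ∈ F, aeval x f = 0 := by
  classical
  cases h with
  | dropZero h0 =>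
    refine ⟨fun h f hf => ?_, fun h f hf => h f (Finset.mem_of_mem_erase hf)⟩
    by_cases hf0 : f = 0
    · rw [hf0, map_zero]
    · exact h f (Finset.mem_erase.2 ⟨hf0, hf⟩)
  | divide f h hf hh hfh h0 m hm hdvd =>
    constructor
    · intro H g hg
      by_cases hgf : g = f
      · have h1 := H _ (Finset.mem_insert_self _ _)
        have h2 := H h (Finset.mem_insert_of_mem (Finset.mem_erase.2 ⟨hfh, hh⟩))
        rw [map_sub, map_mul, h2, mul_zero, sub_zero] at h1
        rw [hgf, h1]
      · exact H g (Finset.mem_insert_of_mem (Finset.mem_erase.2 ⟨hgf, hg⟩))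
    · intro H g hg
      rcases Finset.mem_insert.1 hg with rfl | hg
      · rw [map_sub, map_mul, H f hf, H h hh, mul_zero, sub_zero]
      · exact H g (Finset.mem_of_mem_erase hg)

theorem aeval_eq_aeval_truncIn {x : Fin r → E} {t : Fin r} {j : ℕ} {f : MvPolynomial (Fin r) K}
    (h : ∀ i, j < i → i ≤ f.degreeOf t → aeval x (coeffIn t i f) = 0) :
    aeval x f = aeval x (truncIn t j f) := by
  rcases le_or_gt (f.degreeOf t) j with hj | hj
  · rw [truncIn_eq_self hj]
  · conv_lhs => rw [← truncIn_eq_self (le_refl (f.degreeOf t))]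
    simp only [truncIn, map_sum, map_mul]
    refine (Finset.sum_subset (Finset.range_mono (by omega)) fun i hi hi' => ?_).symm
    rw [h i (by simpa using hi') (Nat.lt_succ_iff.1 (Finset.mem_range.1 hi)), zero_mul]

/-- For pseudo-division, the factor `b` in the inequation permits cancelling `b ^ j` to recover `f =
0` from `u = h = 0`. For a single polynomial, a point belongs to the branch of the last coefficient
not vanishing there. -/
theorem Expand.mem_solutions_iff {S : System r K} {N : Multiset (System r K)} (hN : Expand S N)
    (x : Fin r → E) : x ∈ S.solutions E ↔ ∃ S' ∈ N, x ∈ S'.solutions E := by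
  classical
  cases hN with
  | pseudoDivide hk f h hf hh hne hpos hdeg j a u ha hu heq hlt =>
    have hev := congr_arg (aeval x) heq
    simp only [map_add, map_mul, map_pow] at hev
    simp only [Multiset.insert_eq_cons, Multiset.mem_cons, Multiset.mem_singleton,
      exists_eq_or_imp, exists_eq_left]
    constructor
    · rintro ⟨h1, h2, h3⟩
      by_cases hb : aeval x (leadCoeffIn ⟨S.k, hk⟩ h) = 0
      · refine Or.inr ⟨fun g hg => ?_, h2, h3⟩
        rcases Finset.mem_insert.1 hg with rfl | hg
        exacts [hb, h1 g hg]
      · refine Or.inl ⟨fun g hg => ?_, h2, ?_⟩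
        · rcases Finset.mem_insert.1 hg with rfl | hg
          · rw [h1 f hf, h1 h hh, mul_zero, mul_zero, zero_add] at hev
            exact hev.symm
          · exact h1 g (Finset.mem_of_mem_erase hg)
        · rw [map_mul]
          exact mul_ne_zero hb h3
    · rintro (⟨h1, h2, h3⟩ | ⟨h1, h2, h3⟩)
      · rw [map_mul] at h3
        refine ⟨fun g hg => ?_, h2, right_ne_zero_of_mul h3⟩
        by_cases hgf : g = f
        · rw [h1 u (Finset.mem_insert_self _ _),
            h1 h (Finset.mem_insert_of_mem (Finset.mem_erase.2 ⟨hne, hh⟩)), mul_zero,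
            add_zero] at hev
          rw [hgf]
          exact (mul_eq_zero.1 hev).resolve_left (pow_ne_zero j (left_ne_zero_of_mul h3))
        · exact h1 g (Finset.mem_insert_of_mem (Finset.mem_erase.2 ⟨hgf, hg⟩))
      · exact ⟨fun g hg => h1 g (Finset.mem_insert_of_mem hg), h2, h3⟩
  | lastPolynomial hk f hf hpos huniq =>
    set t : Fin r := ⟨S.k, hk⟩
    constructor
    · rintro ⟨h1, h2, h3⟩
      by_cases hall : ∀ i ≤ f.degreeOf t, aeval x (coeffIn t i f) = 0
      · refine ⟨_, Multiset.mem_cons_self _ _, fun g hg => ?_, h2, h3⟩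
        rcases Finset.mem_union.1 hg with hg | hg
        · exact h1 g (Finset.mem_of_mem_erase hg)
        · obtain ⟨i, hi, rfl⟩ := Finset.mem_image.1 hg
          exact hall i (Nat.lt_succ_iff.1 (Finset.mem_range.1 hi))
      · push Not at hall
        obtain ⟨i₀, hi₀, hne₀⟩ := hall
        let j := Nat.findGreatest (fun i => aeval x (coeffIn t i f) ≠ 0) (f.degreeOf t)
        have hj : aeval x (coeffIn t j f) ≠ 0 :=
          Nat.findGreatest_spec (P := fun i => aeval x (coeffIn t i f) ≠ 0) hi₀ hne₀
        have hjd : j ≤ f.degreeOf t := Nat.findGreatest_le _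
        have hgt : ∀ i, j < i → i ≤ f.degreeOf t → aeval x (coeffIn t i f) = 0 :=
          fun i h h' => not_not.1 (Nat.findGreatest_is_greatest h h')
        have htr := aeval_eq_aeval_truncIn hgt
        rw [h1 f hf] at htr
        -- If only `a_0` could be nonzero at `x`, then `0 = f(x) = a_0(x)`, a contradiction.
        have hj1 : 1 ≤ j := by
          by_contra h0
          obtain h0 : j = 0 := by omega
          rw [h0] at htr hj
          apply hj
          rw [htr]
          simp [truncIn]
        refine ⟨_, Multiset.mem_cons_of_mem (Multiset.mem_map_of_mem _ (a := j)
          (Finset.mem_def.1 (Finset.mem_filter.2 ⟨Finset.mem_Icc.2 ⟨hj1, hjd⟩, ?_⟩))),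
          fun g hg => ?_, fun g hg => ?_, ?_⟩
        · exact fun h => hj (by rw [h, map_zero])
        · rcases Finset.mem_union.1 hg with hg | hg
          · exact h1 g (Finset.mem_of_mem_erase hg)
          · obtain ⟨i, hi, rfl⟩ := Finset.mem_image.1 hg
            exact hgt i (Finset.mem_Ioc.1 hi).1 (Finset.mem_Ioc.1 hi).2
        · rcases Finset.mem_insert.1 hg with rfl | hg
          exacts [htr.symm, h2 g hg]
        · rw [map_mul]
          exact mul_ne_zero h3 hj
    · rintro ⟨S', hS', h1, h2, h3⟩
      rw [Multiset.mem_cons, Multiset.mem_map] at hS'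
      rcases hS' with rfl | ⟨j, hj, rfl⟩
      · refine ⟨fun g hg => ?_, h2, h3⟩
        by_cases hgf : g = f
        · have h0 : ∀ i ≤ g.degreeOf t, aeval x (coeffIn t i g) = 0 := fun i hi =>
            h1 _ (Finset.mem_union_right _ (Finset.mem_image.2
              ⟨i, Finset.mem_range.2 (Nat.lt_succ_of_le (hgf ▸ hi)), by rw [hgf]⟩))
          rw [aeval_eq_aeval_truncIn (j := 0) fun i _ hi => h0 i hi]
          simpa [truncIn] using h0 0 (Nat.zero_le _)
        · exact h1 g (Finset.mem_union_left _ (Finset.mem_erase.2 ⟨hgf, hg⟩))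
      · rw [map_mul] at h3
        refine ⟨fun g hg => ?_, fun g hg => h2 g (Finset.mem_insert_of_mem hg),
          left_ne_zero_of_mul h3⟩
        by_cases hgf : g = f
        · rw [hgf, aeval_eq_aeval_truncIn (j := j) fun i hi hi' =>
            h1 _ (Finset.mem_union_right _ (Finset.mem_image.2
              ⟨i, Finset.mem_Ioc.2 ⟨hi, hi'⟩, rfl⟩))]
          exact h2 _ (Finset.mem_insert_self _ _)
        · exact h1 g (Finset.mem_union_left _ (Finset.mem_erase.2 ⟨hgf, hg⟩))
  | unusedVariable hk hfree =>
    simp only [Multiset.mem_singleton, exists_eq_left]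
    rfl

end Solutions

/-! ### Invariant, progress and termination of runs -/

section Runs

variable {r : ℕ} {K : Type*} [Field K]

/-- The invariant of the algorithm: the systems are semi-triangular, or triangular in the final
loop, and their solution sets cover exactly `V`. -/
def Config.Invariant (V : Set (Fin r → AlgebraicClosure K)) : Config r K → Prop
  | .loop M => (∀ S ∈ M, S.IsSemiTriangular) ∧
      ∀ x, x ∈ V ↔ ∃ S ∈ M, x ∈ S.solutions (AlgebraicClosure K)
  | .reducing S M => S.k < r ∧ (∀ S' ∈ S ::ₘ M, S'.IsSemiTriangular) ∧
      ∀ x, x ∈ V ↔ ∃ S' ∈ S ::ₘ M, x ∈ S'.solutions (AlgebraicClosure K)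
  | .testing M => (∀ S ∈ M, S.IsTriangular) ∧
      ∀ x, x ∈ V ↔ ∃ S ∈ M, x ∈ S.solutions (AlgebraicClosure K)
  | .done b => b = true ↔ V = ∅

theorem Step.invariant {V : Set (Fin r → AlgebraicClosure K)} {c c' : Config r K} (h : Step c c')
    (hc : c.Invariant V) : c'.Invariant V := by
  cases h with
  | pick S M hk => exact ⟨hk, hc⟩
  | reduce S M F hF =>
    obtain ⟨hk, h1, h2⟩ := hc
    refine ⟨hk, fun S' hS' => ?_, fun x => ?_⟩
    · rcases Multiset.mem_cons.1 hS' with rfl | hS'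
      · exact (h1 S (Multiset.mem_cons_self _ _)).of_reduceStep hF
      · exact h1 S' (Multiset.mem_cons_of_mem hS')
    · rw [h2]
      simp only [Multiset.mem_cons, exists_eq_or_imp]
      refine or_congr_left (and_congr_left fun _ => ?_)
      exact (hF.forall_aeval_eq_zero_iff x).symm
  | expand S M N hred hN =>
    obtain ⟨hk, h1, h2⟩ := hc
    refine ⟨fun S' hS' => ?_, fun x => ?_⟩
    · rcases Multiset.mem_add.1 hS' with hS' | hS'
      · exact (h1 S (Multiset.mem_cons_self _ _)).of_expand hN S' hS'
      · exact h1 S' (Multiset.mem_cons_of_mem hS')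
    · rw [h2]
      simp only [Multiset.mem_cons, Multiset.mem_add, or_and_right, exists_or, exists_eq_left,
        hN.mem_solutions_iff]
  | triangulated M hM => exact ⟨fun S hS => (hc.1 S hS).isTriangular (hM S hS), hc.2⟩
  | solvable S M hS =>
    obtain ⟨x, hx⟩ := hS.eq_true_iff.1 rfl
    have : V.Nonempty := ⟨x, (hc.2 x).2 ⟨S, Multiset.mem_cons_self _ _, hx⟩⟩
    simpa [Config.Invariant] using this.ne_empty
  | unsolvable S M hS =>
    refine ⟨fun S' hS' => hc.1 S' (Multiset.mem_cons_of_mem hS'), fun x => ?_⟩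
    have h0 : x ∉ S.solutions (AlgebraicClosure K) := fun hx => by
      simpa using hS.eq_true_iff.2 ⟨x, hx⟩
    rw [hc.2]
    simp [h0]
  | finished =>
    have : V = ∅ := Set.eq_empty_iff_forall_notMem.2 fun x hx => by simpa using (hc.2 x).1 hx
    simp [Config.Invariant, this]

theorem Config.Invariant.exists_step {V : Set (Fin r → AlgebraicClosure K)} {c : Config r K}
    (hc : c.Invariant V) : (∃ b, c = .done b) ∨ ∃ c', Step c c' := by
  cases c with
  | loop M =>
    right
    by_cases h : ∀ S ∈ M, ¬ S.k < r
    · exact ⟨_, .triangulated M h⟩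
    · push Not at h
      obtain ⟨S, hS, hk⟩ := h
      obtain ⟨M, rfl⟩ := Multiset.exists_cons_of_mem hS
      exact ⟨_, .pick S M hk⟩
  | reducing S M =>
    right
    by_cases h : Interreduced S.unsorted
    · obtain ⟨N, hN⟩ := exists_expand (hc.2.1 S (Multiset.mem_cons_self _ _)) hc.1
      exact ⟨_, .expand S M N h hN⟩
    · obtain ⟨F, hF⟩ := exists_reduceStep h
      exact ⟨_, .reduce S M F hF⟩
  | testing M =>
    right
    rcases Multiset.empty_or_exists_mem M with rfl | ⟨S, hS⟩
    · exact ⟨_, .finished⟩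
    · obtain ⟨M, rfl⟩ := Multiset.exists_cons_of_mem hS
      obtain ⟨b, hb⟩ := exists_isSolvable (hc.1 S (Multiset.mem_cons_self _ _))
      cases b with
      | true => exact ⟨_, .solvable S M hb⟩
      | false => exact ⟨_, .unsolvable S M hb⟩
  | done b => exact Or.inl ⟨b, rfl⟩

/-- The data of a state that decrease along a run: the phase, the multiset of systems that still
have to be treated, and whether a system has to be picked next. -/
def Config.measure : Config r K → ℕ × Multiset (System r K) × ℕ
  | .loop M => (2, M, 1)
  | .reducing S M => (2, S ::ₘ M, 0)
  | .testing M => (1, M, 0)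
  | .done _ => (0, 0, 0)

/-- The well-founded relation on states that shows termination. -/
def ConfigLT : Config r K → Config r K → Prop :=
  InvImage (Prod.Lex (· < ·) (Prod.Lex (Relation.CutExpand SystemLT) (· < ·))) Config.measure

/-- Picking a system leaves the multiset unchanged and only lowers the last entry. An expansion
raises that entry again but replaces one system by finitely many smaller ones. -/
theorem wellFounded_configLT : WellFounded (ConfigLT (r := r) (K := K)) :=
  InvImage.wf _ (WellFounded.prod_lex Nat.lt_wfRel.wf
    (WellFounded.prod_lex wellFounded_systemLT.cutExpand Nat.lt_wfRel.wf))

theorem Step.configLT {V : Set (Fin r → AlgebraicClosure K)} {c c' : Config r K} (h : Step c c')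
    (hc : c.Invariant V) : ConfigLT c' c := by
  cases h with
  | pick S M hk => exact .right _ (.right _ Nat.zero_lt_one)
  | reduce S M F hF =>
    obtain ⟨hk, h1, -⟩ := hc
    refine .right _ (.left _ _ ⟨{⟨F, S.sorted, S.k, S.ineq⟩}, S, ?_, ?_⟩)
    · intro S' hS'
      obtain rfl := Multiset.mem_singleton.1 hS'
      exact .of_reduceStep hk (h1 S (Multiset.mem_cons_self _ _)).mem_supported hF
    · simp only [← Multiset.singleton_add]
      abel
  | expand S M N hred hN =>
    obtain ⟨hk, h1, -⟩ := hc
    refine .right _ (.left _ _ ⟨N, S, fun S' hS' => ?_, ?_⟩)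
    · exact .of_expand (h1 S (Multiset.mem_cons_self _ _)).mem_supported hred hN hS'
    · simp only [← Multiset.singleton_add]
      abel
  | triangulated M hM => exact .left _ _ Nat.one_lt_two
  | solvable S M hS => exact .left _ _ Nat.zero_lt_one
  | unsolvable S M hS =>
    refine .right _ (.left _ _ ⟨0, S, by simp, ?_⟩)
    rw [add_zero, add_comm, Multiset.singleton_add]
  | finished => exact .left _ _ Nat.zero_lt_one

theorem invariant_start {s : ℕ} (f : Fin s → MvPolynomial (Fin r) K) :
    (start f).Invariant {x | (∀ i, aeval x (f i) = 0) ∧ ∀ i, x i ≠ 0} := by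
  classical
  refine ⟨fun S hS => ?_, fun x => ?_⟩
  · obtain rfl := Multiset.mem_singleton.1 hS
    exact ⟨Nat.zero_le r, ⟨by simp, by simp⟩, by simp, by simp, by simp⟩
  · simp only [Multiset.mem_singleton, exists_eq_left]
    change _ ↔ (∀ g ∈ _, _) ∧ (∀ g ∈ _, _) ∧ _
    simp [Finset.prod_eq_zero_iff, map_prod]

theorem invariant_of_reflTransGen {V : Set (Fin r → AlgebraicClosure K)} {c c' : Config r K}
    (h : Relation.ReflTransGen Step c c') (hc : c.Invariant V) : c'.Invariant V := by
  induction h with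
  | refl => exact hc
  | tail _ h ih => exact h.invariant ih

theorem not_exists_infinite_run {V : Set (Fin r → AlgebraicClosure K)} {c : Config r K}
    (hc : c.Invariant V) :
    ¬ ∃ run : ℕ → Config r K, run 0 = c ∧ ∀ n, Step (run n) (run (n + 1)) := by
  rintro ⟨run, h0, hrun⟩
  have hinv : ∀ n, (run n).Invariant V := by
    intro n
    induction n with
    | zero => rwa [h0]
    | succ n ih => exact (hrun n).invariant ih
  have hwf := wellFounded_configLT (r := r) (K := K)
  exact (wellFounded_iff_isEmpty_descending_chain.1 hwf).false
    ⟨run, fun n => (hrun n).configLT (hinv n)⟩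

end Runs

/-! ### Monomials in an ideal and zeros in the torus -/

section Torus

variable {r : ℕ} {K : Type*} [Field K]

theorem exists_monomial_mem_iff (I : Ideal (MvPolynomial (Fin r) K)) :
    (∃ ν : Fin r →₀ ℕ, monomial ν (1 : K) ∈ I) ↔
      zeroLocus (AlgebraicClosure K) I ∩ {x : Fin r → AlgebraicClosure K | ∀ i, x i ≠ 0} = ∅ := by
  constructor
  · rintro ⟨ν, hν⟩
    refine Set.eq_empty_iff_forall_notMem.2 fun x ⟨hx, hx0⟩ => ?_
    have := hx _ hν
    rw [aeval_monomial, map_one, one_mul, Finsupp.prod, Finset.prod_eq_zero_iff] at this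
    obtain ⟨i, -, hi⟩ := this
    exact hx0 i (eq_zero_of_pow_eq_zero hi)
  · intro h
    -- The product of the variables vanishes on the whole zero set, so one of its powers, a
    -- monomial, lies in `I`.
    have hmem : (∏ i, X i : MvPolynomial (Fin r) K) ∈ I.radical := by
      rw [← vanishingIdeal_zeroLocus_eq_radical (K := AlgebraicClosure K), mem_vanishingIdeal_iff]
      intro x hx
      by_contra h0
      rw [map_prod, Finset.prod_eq_zero_iff] at h0
      push Not at h0
      refine Set.eq_empty_iff_forall_notMem.1 h x ⟨hx, fun i => ?_⟩
      simpa using h0 i (Finset.mem_univ i)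
    obtain ⟨n, hn⟩ := hmem
    refine ⟨n • ∑ i, Finsupp.single i 1, ?_⟩
    have : (∏ i, X i : MvPolynomial (Fin r) K) = monomial (∑ i, Finsupp.single i 1) 1 :=
      (monomial_sum_one _ _).symm
    rwa [this, monomial_pow, one_pow] at hn

end Torus

end MonomialContainment

theorem mainTheorem1 {K : Type*} [Field K] (r s : ℕ)
    (f : Fin s → MvPolynomial (Fin r) K) :
    -- no infinite run
    (¬ ∃ run : ℕ → MonomialContainment.Config r K,
      run 0 = MonomialContainment.start f ∧
        ∀ n, MonomialContainment.Step (run n) (run (n + 1))) ∧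
    -- a run can only end by returning a truth value
    (∀ c : MonomialContainment.Config r K,
      Relation.ReflTransGen MonomialContainment.Step (MonomialContainment.start f) c →
        (∃ b, c = MonomialContainment.Config.done b) ∨
          ∃ c', MonomialContainment.Step c c') ∧
    -- the returned value is correct
    (∀ b : Bool,
      Relation.ReflTransGen MonomialContainment.Step (MonomialContainment.start f)
          (MonomialContainment.Config.done b) →
        (b = true ↔ ∃ ν : Fin r →₀ ℕ,
          MvPolynomial.monomial ν (1 : K) ∈ Ideal.span (Set.range f))) ∧
    -- ideals with a monomial are those without zeros in the torus
    ((∃ ν : Fin r →₀ ℕ, MvPolynomial.monomial ν (1 : K) ∈ Ideal.span (Set.range f)) ↔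
      MvPolynomial.zeroLocus (AlgebraicClosure K) (Ideal.span (Set.range f)) ∩
        {x : Fin r → AlgebraicClosure K | ∀ i, x i ≠ 0} = ∅) := by
  have hstart := MonomialContainment.invariant_start f
  refine ⟨MonomialContainment.not_exists_infinite_run hstart, fun c hc =>
    (MonomialContainment.invariant_of_reflTransGen hc hstart).exists_step, fun b hb => ?_,
    MonomialContainment.exists_monomial_mem_iff _⟩
  refine (MonomialContainment.invariant_of_reflTransGen hb hstart :).trans ?_
  rw [MonomialContainment.exists_monomial_mem_iff, MvPolynomial.zeroLocus_span]
  have : ({x : Fin r → AlgebraicClosure K | ∀ p ∈ Set.range f, MvPolynomial.aeval x p = 0} ∩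
      {x | ∀ i, x i ≠ 0}) =
      {x | (∀ i, MvPolynomial.aeval x (f i) = 0) ∧ ∀ i, x i ≠ 0} := by
    ext x
    simp
  rw [this]
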